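/- Let $\mathbb S$ be a compact Polish space, $\mathbb O=\mathbb R^p$ with $p<\infty$, and let $\Omega=D([0,\infty);\mathbb S)\times D([0,\infty);\mathbb O)$ be the space of pairs of càdlàg paths, with canonical processes $X_t(x,y)=x(t)$ and $Y_t(x,y)=y(t)$ and the $\sigma$-algebra they generate (the Borel $\sigma$-algebra of the Skorokhod topology). Let $(T_t)_{t\ge0}$ be a Feller semigroup of transition probabilities on $\mathbb S\times\mathbb O$ (conservative, mapping $\mathcal C_0(\mathbb S\times\mathbb O)$ to itself, strongly continuous there), and let $\{\mathbf P_{(x,y)}\}$ be a measurable family of probability measures on $\Omega$ such that under $\mathbf P_{(x,y)}$ the process $(X_t,Y_t)$ is a Markov process with respect to its natural filtration, with these transition probabilities and started at $(x,y)$. Assume that the signal is Markov in its own right and the observations have conditionally independent increments given the signal, in the sense that $\mathbf E_{(x,y)}(\xi)$ does not depend on $y$ for every bounded random variable $\xi$ that is measurable with respect to $\sigma\{X_t,\;Y_t-Y_0:t\ge0\}$. For a probability measure $\rho$ on $\mathbb S\times\mathbb O$ put $\mathbf P_\rho=\int\mathbf P_{(x,y)}\,\rho(dx,dy)$, and for a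 probability measure $\mu$ on $\mathbb S$ put $\mathbf P^\mu=\mathbf P_{\mu\times\delta_0}$. Let $\mathscr F^Y_t$ be the usual augmentation of $\sigma\{Y_s:s\le t\}$ (right-continuous, and completed with respect to the family of all $\mathbf P_\rho$). For every probability measure $\mu$ on $\mathbb S$ and every bounded continuous $f:\mathbb S\to\mathbb R$, the process $t\mapsto\mathbf E^\mu(f(X_t)\mid\mathscr F^Y_t)$ has a version with ($\mathbf P^\mu$-a.s.) càdlàg paths; such versions are used below. Suppose the model is observable: whenever $\mu,\nu$ are probability measures on $\mathbb S$ such that $\mathbf P^\mu$ and $\mathbf P^\nu$ agree on $\sigma\{Y_t:t\ge0\}$, then $\mu=\nu$. Then the filter is stable: for all probability measures $\mu\ll\nu$ on $\mathbb S$ and every bounded continuous $f:\mathbb S\to\mathbb R$, $$\bigl|\mathbf E^\mu(f(X_t)\mid\mathscr F^Y_t)-\mathbf E^\nu(f(X_t)\mid\mathscr F^Y_t)\bigr|\xrightarrow[t\to\infty]{}0\qquad\mathbf P^\mu\text{-a.s.}$$ -/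

import Mathlib

open MeasureTheory ProbabilityTheory Filter Topology
open scoped NNReal ProbabilityTheory BoundedContinuousFunction ZeroAtInfty

noncomputable section

namespace FilterStability

/-- A path `[0,∞) → E` is càdlàg: right-continuous with left limits.
(At `t = 0` the left limit condition is empty, since `𝓝[<] (0 : ℝ≥0) = ⊥`.) -/
def IsCadlag {E : Type*} [TopologicalSpace E] (x : ℝ≥0 → E) : Prop :=
  ∀ t, ContinuousWithinAt x (Set.Ici t) t ∧ ∃ l, Tendsto x (𝓝[<] t) (𝓝 l)

/-- The space `D([0,∞); E)` of càdlàg paths. -/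
def CadlagPath (E : Type*) [TopologicalSpace E] : Type _ :=
  {x : ℝ≥0 → E // IsCadlag x}

/-- The σ-algebra on `D([0,∞); E)` generated by the coordinate maps `x ↦ x(t)`.  For Polish `E`
this is the Borel σ-algebra of the Skorokhod topology. -/
instance {E : Type*} [TopologicalSpace E] [MeasurableSpace E] :
    MeasurableSpace (CadlagPath E) :=
  ⨆ t : ℝ≥0, MeasurableSpace.comap (fun x : CadlagPath E => x.1 t) inferInstance

theorem CadlagPath.measurable_coord {E : Type*} [TopologicalSpace E] [MeasurableSpace E]
    (t : ℝ≥0) : Measurable (fun x : CadlagPath E => x.1 t) :=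
  Measurable.mono (comap_measurable _)
    (le_iSup (fun t : ℝ≥0 =>
      MeasurableSpace.comap (fun x : CadlagPath E => x.1 t) inferInstance) t) le_rfl

/-- A Feller semigroup of Markov transition kernels on `E`: a conservative transition semigroup
`f ↦ (z ↦ ∫ f dT_t(z, ·))` which maps `C₀(E)` to itself and is strongly continuous on `C₀(E)`. -/
structure IsFellerSemigroup {E : Type*} [TopologicalSpace E] [MeasurableSpace E]
    (T : ℝ≥0 → Kernel E E) : Prop where
  isMarkov : ∀ t, IsMarkovKernel (T t)
  zero : T 0 = Kernel.id
  add : ∀ s t, T (s + t) = T t ∘ₖ T s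
  map_zeroAtInfty : ∀ (t : ℝ≥0) (f : C₀(E, ℝ)), ∃ g : C₀(E, ℝ), ∀ z, g z = ∫ w, f w ∂(T t z)
  strongly_continuous : ∀ f : C₀(E, ℝ),
    TendstoUniformly (fun (t : ℝ≥0) z => ∫ w, f w ∂(T t z)) (fun z => f z) (𝓝 0)

/-- The observation state space `ℝ^p`. -/
abbrev Obs (p : ℕ) : Type := EuclideanSpace ℝ (Fin p)

/-- The canonical space `Ω = D([0,∞); S) × D([0,∞); ℝ^p)`. -/
abbrev PathSpace (S : Type*) [TopologicalSpace S] (p : ℕ) : Type _ :=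
  CadlagPath S × CadlagPath (Obs p)

section Canonical

variable {S : Type*} [TopologicalSpace S] {p : ℕ}

/-- The canonical signal process `X_t(x, y) = x(t)`. -/
def X (t : ℝ≥0) (ω : PathSpace S p) : S := ω.1.1 t

/-- The canonical observation process `Y_t(x, y) = y(t)`. -/
def Y (t : ℝ≥0) (ω : PathSpace S p) : Obs p := ω.2.1 t

/-- The pair process `(X_t, Y_t)`. -/
def XY (t : ℝ≥0) (ω : PathSpace S p) : S × Obs p := (X t ω, Y t ω)

variable [MeasurableSpace S]

theorem measurable_X (t : ℝ≥0) : Measurable (X (S := S) (p := p) t) :=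
  (CadlagPath.measurable_coord t).comp measurable_fst

theorem measurable_Y (t : ℝ≥0) : Measurable (Y (S := S) (p := p) t) :=
  (CadlagPath.measurable_coord t).comp measurable_snd

theorem measurable_XY (t : ℝ≥0) : Measurable (XY (S := S) (p := p) t) :=
  (measurable_X t).prodMk (measurable_Y t)

end Canonical

/-- The (raw) filtration `t ↦ σ(Z_s : s ≤ t)` generated by a process `Z`. -/
def generated {Ω E : Type*} [mΩ : MeasurableSpace Ω] [MeasurableSpace E] (Z : ℝ≥0 → Ω → E)
    (hZ : ∀ t, Measurable (Z t)) : Filtration ℝ≥0 mΩ where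
  seq t := ⨆ s ≤ t, MeasurableSpace.comap (Z s) inferInstance
  mono' _ _ hst := biSup_mono fun _ h => le_trans h hst
  le' _ := iSup₂_le fun s _ => (hZ s).comap_le

section Sigma

variable (S : Type*) [TopologicalSpace S] [MeasurableSpace S] (p : ℕ)

/-- `𝓕_t = σ((X_s, Y_s) : s ≤ t)`. -/
def fullFiltration :
    Filtration ℝ≥0 (inferInstance : MeasurableSpace (PathSpace S p)) :=
  generated XY measurable_XY

/-- `𝓕^Y_t = σ(Y_s : s ≤ t)`, before augmentation. -/
def rawObsFiltration :
    Filtration ℝ≥0 (inferInstance : MeasurableSpace (PathSpace S p)) :=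
  generated Y measurable_Y

/-- `𝓕^X = σ(X_t : t ≥ 0)`. -/
@[reducible] def signalSigma : MeasurableSpace (PathSpace S p) :=
  ⨆ t : ℝ≥0, MeasurableSpace.comap (X t) inferInstance

/-- `𝓕^Y = σ(Y_t : t ≥ 0)`. -/
@[reducible] def obsSigma : MeasurableSpace (PathSpace S p) :=
  ⨆ t : ℝ≥0, MeasurableSpace.comap (Y t) inferInstance

/-- `𝓖^Y = σ(Y_t - Y_0 : t ≥ 0)`, generated by the observation increments. -/
@[reducible] def obsIncrementSigma : MeasurableSpace (PathSpace S p) :=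
  ⨆ t : ℝ≥0, MeasurableSpace.comap (fun ω : PathSpace S p => Y t ω - Y 0 ω) inferInstance

end Sigma

/-- The signal-observation model with signal state space `S` and observation state space `ℝ^p`:
a Feller semigroup `trans` on `S × ℝ^p`, together with the laws `law (x, y) = P_(x,y)` on the
canonical càdlàg path space of the Markov process with this semigroup started at `(x, y)`, such
that the signal is Markov in its own right and the observations have conditionally independent
increments given the signal. -/
structure FilteringModel (S : Type*) [TopologicalSpace S] [MeasurableSpace S] (p : ℕ) where
  /-- transition probabilities of `(X_t, Y_t)` -/
  trans : ℝ≥0 → Kernel (S × Obs p) (S × Obs p)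
  feller : IsFellerSemigroup trans
  /-- the laws `P_(x,y)` -/
  law : Kernel (S × Obs p) (PathSpace S p)
  isMarkovKernel_law : IsMarkovKernel law
  initial : ∀ z, (law z).map (XY 0) = Measure.dirac z
  markov : ∀ (z : S × Obs p) (s t : ℝ≥0) (A : Set (S × Obs p)), MeasurableSet A →
    (law z)[(XY (s + t) ⁻¹' A).indicator (fun _ => (1 : ℝ)) | fullFiltration S p s]
      =ᵐ[law z] fun ω => (trans t (XY s ω)).real A
  /-- `E_(x,y)(ξ)` does not depend on `y` for bounded `𝓕^X ∨ 𝓖^Y`-measurable `ξ` -/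
  cond_indep_increments : ∀ ξ : PathSpace S p → ℝ,
    Measurable[signalSigma S p ⊔ obsIncrementSigma S p] ξ → (∃ C, ∀ ω, |ξ ω| ≤ C) →
    ∀ (x : S) (y y' : Obs p), ∫ ω, ξ ω ∂(law (x, y)) = ∫ ω, ξ ω ∂(law (x, y'))

namespace FilteringModel

variable {S : Type*} [TopologicalSpace S] [MeasurableSpace S] {p : ℕ}

/-- `P_ρ(A) = ∫ P_(x,y)(A) ρ(dx, dy)` for an initial law `ρ` on `S × ℝ^p`. -/
def lawOf (M : FilteringModel S p) (ρ : Measure (S × Obs p)) : Measure (PathSpace S p) :=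
  ρ.bind M.law

/-- `P^μ = P_(μ × δ₀)` for an initial law `μ` of the signal. -/
def signalLaw (M : FilteringModel S p) (μ : Measure S) : Measure (PathSpace S p) :=
  M.lawOf (μ.prod (Measure.dirac 0))

/-- The usual augmentation of `𝓕^Y_t = σ(Y_s : s ≤ t)` with respect to the family of all `P_ρ`:
right-continuous, and completed by the null sets of each `P_ρ`. -/
def obsFiltration (M : FilteringModel S p) :
    Filtration ℝ≥0 (inferInstance : MeasurableSpace (PathSpace S p)) where
  seq t :=
    { MeasurableSet' := fun A => MeasurableSet A ∧
        ∀ s > t, ∀ ρ : Measure (S × Obs p), IsProbabilityMeasure ρ →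
          ∃ B, MeasurableSet[rawObsFiltration S p s] B ∧ A =ᵐ[M.lawOf ρ] B
      measurableSet_empty := ⟨MeasurableSet.empty, fun s _ ρ _ =>
        ⟨∅, @MeasurableSet.empty _ (rawObsFiltration S p s), ae_eq_rfl⟩⟩
      measurableSet_compl := fun A hA => ⟨hA.1.compl, fun s hs ρ hρ => by
        obtain ⟨B, hB, hAB⟩ := hA.2 s hs ρ hρ
        exact ⟨Bᶜ, MeasurableSet.compl hB, hAB.compl⟩⟩
      measurableSet_iUnion := fun A hA =>
        ⟨MeasurableSet.iUnion fun i => (hA i).1, fun s hs ρ hρ => by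
          choose B hB hAB using fun i => (hA i).2 s hs ρ hρ
          exact ⟨⋃ i, B i, MeasurableSet.iUnion hB, Filter.EventuallyEq.countable_iUnion hAB⟩⟩ }
  mono' _ _ hst := fun _ hA => ⟨hA.1, fun r hr => hA.2 r (lt_of_le_of_lt hst hr)⟩
  le' _ := fun _ hA => hA.1

/-- The model is observable if distinct initial laws of the signal never induce the same law of the
observation process, i.e. if `P^μ = P^ν` on `𝓕^Y` implies `μ = ν`. -/
def IsObservable (M : FilteringModel S p) : Prop :=
  ∀ μ ν : Measure S, IsProbabilityMeasure μ → IsProbabilityMeasure ν →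
    (∀ A, MeasurableSet[obsSigma S p] A → M.signalLaw μ A = M.signalLaw ν A) → μ = ν

/-- `π` is a càdlàg version of the filter `t ↦ E^μ(f(X_t) | 𝓕^Y_t)`. -/
structure IsFilter (M : FilteringModel S p) (μ : Measure S) (f : S →ᵇ ℝ)
    (π : ℝ≥0 → PathSpace S p → ℝ) : Prop where
  ae_eq_condExp : ∀ t, π t =ᵐ[M.signalLaw μ]
    (M.signalLaw μ)[fun ω => f (X t ω) | M.obsFiltration t]
  cadlag : ∀ᵐ ω ∂(M.signalLaw μ), IsCadlag (fun t => π t ω)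

/-- The filtering model is stable: for `μ ≪ ν` and every bounded continuous `f`, almost surely
`|E^μ(f(X_t) | 𝓕^Y_t) - E^ν(f(X_t) | 𝓕^Y_t)| → 0` under `P^μ`. -/
def IsStable (M : FilteringModel S p) : Prop :=
  ∀ μ ν : Measure S, IsProbabilityMeasure μ → IsProbabilityMeasure ν → μ ≪ ν →
    ∀ (f : S →ᵇ ℝ) (πμ πν : ℝ≥0 → PathSpace S p → ℝ),
      M.IsFilter μ f πμ → M.IsFilter ν f πν →
      ∀ᵐ ω ∂(M.signalLaw μ), Tendsto (fun t => |πμ t ω - πν t ω|) atTop (𝓝 0)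

end FilteringModel

end FilterStability

end

/-! Filtering the present signal can be read as predicting future observations, and predictions
under mutually dominated laws merge.

For a finite product ψ of bounded continuous functions of the increments `Y_r - Y_0`, the function
g(x) = E_(x,y)(ψ) does not depend on y and is continuous by the Feller property. By the Markov
property, E(g(X_t) | 𝓕^Y_t) = E(ψ∘θ_t | 𝓕^Y_t), with θ_t the time shift
(`condExp_obsProd_pathShift`). Since the right side only concerns observations after time t, the
Blackwell–Dubins theorem (`ae_tendsto_condExp_sub_condExp`) shows that its versions under `P^μ` and
`P^ν` merge `P^μ`-a.s. Its engine is Bayes' formula: with Λ the density of `P^μ` with respect to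
`P^ν`, the discrepancy is controlled by how far the martingale of Λ still is from its limit, which
Lévy's upward theorem and Doob's maximal inequality make small.

Observability says exactly that these functions g separate probability measures on `S`. As they
include the constant 1, Hahn–Banach, the decomposition of a functional into positive parts and Riesz
representation make their span dense in C(S) (`dense_span_obsProdExpectation`). Conditional
expectation is a contraction in the sup norm, so merging extends to every f.

Conditional expectations are only defined up to null sets, so all pathwise statements are first
proved on the countable set of dyadic times and then carried to all times by right-continuity.

Existence of the càdlàg version rests on another regularization. The signal has a strongly
continuous semigroup on C(S), hence a dense set of g with ‖T_t g - g‖ ≤ ct. For such g the estimate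
of g(X_t) plus ct is a submartingale, and the upcrossing inequality yields one-sided dyadic limits.
These pass to uniform limits, and the right limit is the required version. -/

namespace FilterStability

/-! ### Dyadic times. -/

/-- The dyadic times with mesh `2⁻ⁿ` up to time `n`. -/
def dyadicGrid (n : ℕ) : Set ℝ≥0 := {t | ∃ k : ℕ, k ≤ n * 2 ^ n ∧ t = k / 2 ^ n}

/-- The set of all nonnegative dyadic rationals. -/
def dyadics : Set ℝ≥0 := ⋃ n, dyadicGrid n

theorem dyadicGrid_mono : Monotone dyadicGrid := by
  refine monotone_nat_of_le_succ fun n => ?_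
  rintro t ⟨k, hk, rfl⟩
  refine ⟨2 * k, ?_, ?_⟩
  · rw [pow_succ]; nlinarith [Nat.two_pow_pos n]
  · rw [pow_succ]; push_cast; field_simp

theorem div_mem_dyadics (n k : ℕ) : (k / 2 ^ n : ℝ≥0) ∈ dyadics := by
  -- The grid of level m also stops at time m, so the level must be at least k/2ⁿ as well as at
  -- least n; `max n k` achieves both.
  refine Set.mem_iUnion.2 ⟨max n k, ⟨k * 2 ^ (max n k - n), ?_, ?_⟩⟩
  · gcongr
    · exact le_max_right _ _
    · norm_num
    · exact Nat.sub_le _ _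
  · have : (2 : ℝ≥0) ^ (max n k) = 2 ^ (max n k - n) * 2 ^ n := by
      rw [← pow_add, Nat.sub_add_cancel (le_max_left _ _)]
    rw [this]; push_cast; field_simp

theorem countable_dyadics : dyadics.Countable := by
  refine Set.countable_iUnion fun n => ?_
  refine (Set.countable_range fun k : ℕ => (k / 2 ^ n : ℝ≥0)).mono ?_
  rintro t ⟨k, -, rfl⟩
  exact ⟨k, rfl⟩

theorem exists_dyadic_between {s t : ℝ≥0} (h : s < t) : ∃ q ∈ dyadics, s < q ∧ q < t := by
  obtain ⟨n, hn⟩ := exists_nat_gt (1 / ((t : ℝ) - s))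
  have hst : (0 : ℝ) < (t : ℝ) - s := sub_pos.2 (by exact_mod_cast h)
  have h2 : (1 : ℝ) / 2 ^ n < t - s := by
    rw [div_lt_iff₀ (by positivity)]
    rw [div_lt_iff₀ hst] at hn
    have : (n : ℝ) < 2 ^ n := by exact_mod_cast Nat.lt_two_pow_self
    nlinarith
  have hp : (0 : ℝ) < 2 ^ n := by positivity
  refine ⟨((⌊(s : ℝ) * 2 ^ n⌋₊ + 1 : ℕ) / 2 ^ n : ℝ≥0), div_mem_dyadics _ _, ?_, ?_⟩
  · rw [← NNReal.coe_lt_coe]; push_cast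
    rw [lt_div_iff₀ hp]
    exact Nat.lt_floor_add_one _
  · rw [← NNReal.coe_lt_coe]; push_cast
    rw [div_lt_iff₀ hp]
    have := Nat.floor_le (a := (s : ℝ) * 2 ^ n) (by positivity)
    rw [div_lt_iff₀ hp] at h2
    nlinarith

/-- Makes right limits along dyadics unique, which is what lets statements pass from dyadic times to
all times. -/
instance neBot_nhdsWithin_dyadics_Ioi (t : ℝ≥0) : (𝓝[dyadics ∩ Set.Ioi t] t).NeBot := by
  rw [← mem_closure_iff_nhdsWithin_neBot, mem_closure_iff_nhds]
  intro U hU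
  obtain ⟨u, hu, hU'⟩ := (mem_nhdsGE_iff_exists_Ico_subset' (a := t) (u' := t + 1) (by simp)).1
    (nhdsWithin_le_nhds hU)
  obtain ⟨q, hq, h1, h2⟩ := exists_dyadic_between hu
  exact ⟨q, hU' ⟨h1.le, h2⟩, hq, h1⟩

/-! ### Merging of conditional expectations under an absolutely continuous change of law. -/

section Discretization

variable {Ω : Type*} {m0 : MeasurableSpace Ω}

/-- A continuous-time filtration sampled at the times `k / 2ⁿ`. -/
noncomputable def sampledFiltration (F : Filtration ℝ≥0 m0) (n : ℕ) : Filtration ℕ m0 where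
  seq k := F (k / 2 ^ n)
  mono' i j hij := F.mono (by gcongr)
  le' k := F.le _

variable {P Q : Measure Ω}

/-- Doob's maximal inequality for a closed martingale along the dyadic times. -/
theorem measure_exists_dyadic_lt_condExp [IsFiniteMeasure P] (F : Filtration ℝ≥0 m0) {W : Ω → ℝ}
    (hW0 : 0 ≤ W) {ε : ℝ≥0} (hε : 0 < ε) :
    P {ω | ∃ t ∈ dyadics, (ε : ℝ) < (P[W | F t]) ω} ≤ ENNReal.ofReal (∫ ω, W ω ∂P) / ε := by
  have hset : {ω | ∃ t ∈ dyadics, (ε : ℝ) < (P[W | F t]) ω}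
      = ⋃ n, {ω | ∃ t ∈ dyadicGrid n, (ε : ℝ) < (P[W | F t]) ω} := by
    ext ω; simp only [dyadics, Set.mem_iUnion, Set.mem_ofPred_eq]; tauto
  have hmono : Monotone fun n => {ω | ∃ t ∈ dyadicGrid n, (ε : ℝ) < (P[W | F t]) ω} :=
    fun m n hmn ω ⟨t, ht, h⟩ => ⟨t, dyadicGrid_mono hmn ht, h⟩
  rw [hset, hmono.measure_iUnion]
  refine iSup_le fun n => ?_
  have hmart : Martingale (fun k => P[W | sampledFiltration F n k]) (sampledFiltration F n) P :=
    martingale_condExp _ _ _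
  -- The discrete maximal inequality wants a process that is nonnegative everywhere, while
  -- conditional expectations are so only almost surely; the positive part repairs this without
  -- changing the integrals.
  have hsub := hmart.submartingale.pos
  have hmax := maximal_ineq hsub (fun _ _ => le_sup_right) (ε := ε) (n * 2 ^ n)
  rw [ENNReal.le_div_iff_mul_le (Or.inl (by simpa using hε.ne')) (Or.inl (by simp)), mul_comm]
  refine le_trans ?_ (hmax.trans ?_)
  · gcongr with ω
    rintro ⟨t, ⟨k, hk, rfl⟩, h⟩
    refine h.le.trans ((le_max_left ((P[W | F (k / 2 ^ n)]) ω) 0).trans ?_)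
    exact Finset.le_sup' (fun k : ℕ => ((P[W | sampledFiltration F n k])⁺) ω)
      (Finset.mem_range.2 (Nat.lt_succ_of_le hk))
  · refine ENNReal.ofReal_le_ofReal ?_
    have hnn : 0 ≤ᵐ[P] P[W | sampledFiltration F n (n * 2 ^ n)] :=
      condExp_nonneg (Eventually.of_forall hW0)
    calc _ ≤ ∫ ω, ((P[W | sampledFiltration F n (n * 2 ^ n)])⁺) ω ∂P :=
          setIntegral_le_integral (hsub.integrable _) (Eventually.of_forall fun ω => le_sup_right)
      _ = ∫ ω, (P[W | sampledFiltration F n (n * 2 ^ n)]) ω ∂P := by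
          refine integral_congr_ae ?_
          filter_upwards [hnn] with ω hω
          exact max_eq_left hω
      _ = _ := integral_condExp ((sampledFiltration F n).le _)

end Discretization
end FilterStability

namespace FilterStability
section Discretization

variable {Ω : Type*} {m0 : MeasurableSpace Ω} {P Q : Measure Ω}

theorem iSup_natCast_filtration (F : Filtration ℝ≥0 m0) :
    ⨆ n : ℕ, F (n : ℝ≥0) = ⨆ t, F t := by
  refine le_antisymm (iSup_le fun n => le_iSup (fun t => F t) (n : ℝ≥0)) (iSup_le fun t => ?_)
  obtain ⟨n, hn⟩ := exists_nat_ge t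
  exact (F.mono hn).trans (le_iSup (fun n : ℕ => F (n : ℝ≥0)) n)

/-- Lévy's upward theorem in `L¹` along the integers of a continuous-time filtration. -/
theorem tendsto_integral_abs_condExp_sub [IsFiniteMeasure P] (F : Filtration ℝ≥0 m0) (g : Ω → ℝ) :
    Tendsto (fun n : ℕ => ∫ ω, |(P[g | ⨆ t, F t]) ω - (P[g | F n]) ω| ∂P) atTop (𝓝 0) := by
  let G : Filtration ℕ m0 :=
    { seq := fun n => F n
      mono' := fun i j hij => F.mono (by exact_mod_cast hij)
      le' := fun n => F.le _ }
  have h := tendsto_eLpNorm_condExp (μ := P) (ℱ := G) g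
  have h2 := (ENNReal.tendsto_toReal ENNReal.zero_ne_top).comp h
  refine h2.congr fun n => ?_
  have : ⨆ n, G n = ⨆ t, F t := iSup_natCast_filtration F
  rw [Function.comp, this, eLpNorm_one_eq_lintegral_enorm,
    ← integral_norm_eq_lintegral_enorm
      (integrable_condExp.sub integrable_condExp).aestronglyMeasurable]
  refine integral_congr_ae (Eventually.of_forall fun ω => ?_)
  simp only [Pi.sub_apply, Real.norm_eq_abs]
  exact abs_sub_comm _ _

/-- Bayes' formula: the conditional expectation under `Q ≪ P` in terms of the one under `P`. -/
theorem condExp_rnDeriv_mul [IsProbabilityMeasure P] [IsProbabilityMeasure Q] (hQP : Q ≪ P)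
    {m : MeasurableSpace Ω} (hm : m ≤ m0) {Z : Ω → ℝ} (hZ : Measurable[m0] Z) {C : ℝ}
    (hC : ∀ ω, |Z ω| ≤ C) :
    (fun ω => (P[fun ω => (Q.rnDeriv P ω).toReal | m]) ω * (Q[Z | m]) ω)
      =ᵐ[Q] P[fun ω => (Q.rnDeriv P ω).toReal * Z ω | m] := by
  have hΛ : Integrable (fun ω => (Q.rnDeriv P ω).toReal) P := Measure.integrable_toReal_rnDeriv
  have hZQ : Integrable Z Q := .of_bound hZ.aestronglyMeasurable C (Eventually.of_forall hC)
  have hC0 : 0 ≤ C := by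
    obtain ⟨ω⟩ : Nonempty Ω := nonempty_of_isProbabilityMeasure P
    exact (abs_nonneg _).trans (hC ω)
  have key : ∀ f : Ω → ℝ, ∀ s, MeasurableSet[m0] s →
      ∫ ω in s, (Q.rnDeriv P ω).toReal * f ω ∂P = ∫ ω in s, f ω ∂Q := fun f s hs =>
    setIntegral_rnDeriv_smul (f := f) hQP hs
  -- `Q[Z | m]` is bounded only `Q`-a.e., which says nothing about its integrability under `P`. The
  -- truncation `R` is bounded everywhere and still a `Q`-version.
  set R : Ω → ℝ := fun ω => max (-C) (min C ((Q[Z | m]) ω)) with hR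
  have hRm : StronglyMeasurable[m] R :=
    stronglyMeasurable_const.sup (stronglyMeasurable_const.inf stronglyMeasurable_condExp)
  have hRC : ∀ ω, ‖R ω‖ ≤ C := fun ω => by
    rw [Real.norm_eq_abs, abs_le]
    exact ⟨le_max_left _ _, max_le (by linarith) (min_le_left _ _)⟩
  have hRQ : R =ᵐ[Q] Q[Z | m] := by
    filter_upwards [ae_bdd_abs_condExp_of_ae_bdd_abs (m := m) (μ := Q)
      (Eventually.of_forall hC)] with ω hω
    rw [abs_le] at hω
    simp only [hR, min_eq_right hω.2, max_eq_right hω.1]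
  have hΛR : Integrable (fun ω => (Q.rnDeriv P ω).toReal * R ω) P :=
    hΛ.mul_bdd (c := C) (hRm.mono hm).aestronglyMeasurable (Eventually.of_forall hRC)
  have hΛZ : Integrable (fun ω => (Q.rnDeriv P ω).toReal * Z ω) P :=
    hΛ.mul_bdd (c := C) hZ.aestronglyMeasurable (Eventually.of_forall hC)
  have h1 : P[fun ω => (Q.rnDeriv P ω).toReal * R ω | m]
      =ᵐ[P] P[fun ω => (Q.rnDeriv P ω).toReal * Z ω | m] := by
    refine ae_eq_condExp_of_forall_setIntegral_eq hm hΛZ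
      (fun s _ _ => integrable_condExp.integrableOn) (fun s hs _ => ?_)
      stronglyMeasurable_condExp.aestronglyMeasurable
    rw [setIntegral_condExp hm hΛR hs, key _ _ (hm s hs), key _ _ (hm s hs),
      ← setIntegral_condExp hm hZQ hs]
    exact integral_congr_ae (ae_restrict_of_ae hRQ)
  have h2 := condExp_mul_of_stronglyMeasurable_right hRm hΛR hΛ
  filter_upwards [hRQ, hQP.ae_le h1, hQP.ae_le h2] with ω e1 e2 e3
  rw [← e1, ← e2]
  exact e3.symm

/-- For an integrable `g` measurable with respect to the terminal σ-algebra, the conditional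
expectations `P[|g - P[g | F k]| | F t]` are small along dyadic `t`, uniformly, for some `k`. -/
theorem ae_exists_forall_condExp_abs_sub_lt [IsProbabilityMeasure P] (F : Filtration ℝ≥0 m0)
    (g : Ω → ℝ) :
    ∀ᵐ ω ∂P, ∀ ε > 0, ∃ k : ℕ,
      |(P[g | ⨆ t, F t]) ω - (P[g | F k]) ω| < ε ∧
      ∀ t ∈ dyadics, (P[fun ω => |(P[g | ⨆ t, F t]) ω - (P[g | F k]) ω| | F t]) ω < ε := by
  set W : ℕ → Ω → ℝ := fun k ω => |(P[g | ⨆ t, F t]) ω - (P[g | F k]) ω| with hW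
  have hWi : ∀ k, Integrable (W k) P := fun k => (integrable_condExp.sub integrable_condExp).abs
  have hW0 : ∀ k, 0 ≤ W k := fun k ω => abs_nonneg _
  have hlim : Tendsto (fun k => ENNReal.ofReal (∫ ω, W k ω ∂P)) atTop (𝓝 0) := by
    simpa using ENNReal.tendsto_ofReal (tendsto_integral_abs_condExp_sub (P := P) F g)
  have main : ∀ ε : ℝ≥0, 0 < ε → ∀ᵐ ω ∂P, ∃ k : ℕ, W k ω ≤ ε ∧
      ∀ t ∈ dyadics, (P[W k | F t]) ω ≤ ε := by
    intro ε hε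
    rw [ae_iff]
    -- The bad event fails for every k at once, so it lies in the bad event of each single k.
    -- Markov's inequality for `W k` and Doob's for its martingale each give E(W k)/ε, and k is then
    -- sent to infinity; no subsequence is needed.
    have hle : ∀ k, P {ω | ¬ ∃ k : ℕ, W k ω ≤ ε ∧ ∀ t ∈ dyadics, (P[W k | F t]) ω ≤ ε}
        ≤ ENNReal.ofReal (∫ ω, W k ω ∂P) / ε + ENNReal.ofReal (∫ ω, W k ω ∂P) / ε := by
      intro k
      have hsub : {ω | ¬ ∃ k : ℕ, W k ω ≤ ε ∧ ∀ t ∈ dyadics, (P[W k | F t]) ω ≤ ε}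
          ⊆ {ω | (ε : ℝ) ≤ W k ω} ∪ {ω | ∃ t ∈ dyadics, (ε : ℝ) < (P[W k | F t]) ω} := by
        intro ω hω
        by_contra hcon
        simp only [Set.mem_union, Set.mem_ofPred_eq, not_or, not_le, not_exists, not_and,
          not_lt] at hcon
        exact hω ⟨k, hcon.1.le, hcon.2⟩
      refine (measure_mono hsub).trans ((measure_union_le _ _).trans (add_le_add ?_ ?_))
      · rw [ENNReal.le_div_iff_mul_le (Or.inl (by simpa using hε.ne')) (Or.inl (by simp)),
          mul_comm, ofReal_integral_eq_lintegral_ofReal (hWi k) (Eventually.of_forall (hW0 k))]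
        refine le_trans (le_of_eq ?_) (mul_meas_ge_le_lintegral₀
          (hWi k).aestronglyMeasurable.aemeasurable.ennreal_ofReal (ε : ENNReal))
        congr 2
        ext ω
        simp only [Set.mem_ofPred_eq]
        rw [← ENNReal.ofReal_coe_nnreal, ENNReal.ofReal_le_ofReal_iff (hW0 k ω)]
      · exact measure_exists_dyadic_lt_condExp F (hW0 k) hε
    refine le_antisymm (ge_of_tendsto' (x := atTop) ?_ hle) bot_le
    have h3 := ENNReal.Tendsto.div_const hlim (b := (ε : ENNReal)) (Or.inr (by simpa using hε.ne'))
    simpa using h3.add h3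
  have main' : ∀ᵐ ω ∂P, ∀ n : ℕ, ∃ k : ℕ, W k ω ≤ ((1 / (n + 1) : ℝ≥0) : ℝ) ∧
      ∀ t ∈ dyadics, (P[W k | F t]) ω ≤ ((1 / (n + 1) : ℝ≥0) : ℝ) :=
    ae_all_iff.2 fun n => main _ (by positivity)
  filter_upwards [main'] with ω hω ε hε
  obtain ⟨n, hn⟩ := exists_nat_one_div_lt hε
  obtain ⟨k, h1, h2⟩ := hω n
  push_cast at h1 h2
  exact ⟨k, h1.trans_lt hn, fun t ht => (h2 t ht).trans_lt hn⟩

end Discretization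
end FilterStability

namespace FilterStability
section Discretization

variable {Ω : Type*} {m0 : MeasurableSpace Ω} {P Q : Measure Ω}

/-- The event where the conditional density is nonpositive belongs to `m`, so its `Q`-mass is the
integral of that density over it. Positivity allows the weight to be divided out at the end of the
merging argument. -/
theorem ae_pos_condExp_rnDeriv [IsProbabilityMeasure P] [IsProbabilityMeasure Q] (hQP : Q ≪ P)
    {m : MeasurableSpace Ω} (hm : m ≤ m0) :
    ∀ᵐ ω ∂Q, 0 < (P[fun ω => (Q.rnDeriv P ω).toReal | m]) ω := by
  set Λ : Ω → ℝ := fun ω => (Q.rnDeriv P ω).toReal with hΛdef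
  have hΛ : Integrable Λ P := Measure.integrable_toReal_rnDeriv
  have hnn : 0 ≤ᵐ[P] P[Λ | m] :=
    condExp_nonneg (Eventually.of_forall fun ω => ENNReal.toReal_nonneg)
  set s : Set Ω := {ω | (P[Λ | m]) ω ≤ 0} with hs
  have hsm : MeasurableSet[m] s :=
    (stronglyMeasurable_condExp (f := Λ) (m := m) (μ := P)).measurable measurableSet_Iic
  have h1 : ∫ ω in s, Λ ω ∂P ≤ 0 := by
    rw [← setIntegral_condExp hm hΛ hsm]
    exact setIntegral_nonpos (hm s hsm) fun ω hω => hω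
  have h2 : Q.real s = ∫ ω in s, Λ ω ∂P := by
    rw [Measure.setIntegral_toReal_rnDeriv hQP]
  have h3 : Q s = 0 := by
    have : Q.real s = 0 := le_antisymm (h2 ▸ h1) measureReal_nonneg
    rwa [measureReal_eq_zero_iff] at this
  rw [ae_iff]
  refine measure_mono_null (fun ω hω => ?_) h3
  exact not_lt.1 hω

/-- Write Λ_t and Λ_∞ for the conditional densities. Bayes gives Λ_t Q[Z|F_t] = P[ΛZ|F_t], where Λ
may be replaced by Λ_∞ because `Z` is terminal-measurable; also Λ_t P[Z|F_t] = P[Λ_t Z|F_t]. The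
difference is P[(Λ_∞ - Λ_t)Z | F_t]. -/
theorem ae_condExp_rnDeriv_mul_sub_le [IsProbabilityMeasure P] [IsProbabilityMeasure Q]
    (hQP : Q ≪ P) (F : Filtration ℝ≥0 m0) {Z : Ω → ℝ} (hZ : Measurable[⨆ t, F t] Z) {C : ℝ}
    (hC : ∀ ω, |Z ω| ≤ C) (t : ℝ≥0) :
    ∀ᵐ ω ∂Q, |(P[fun ω => (Q.rnDeriv P ω).toReal | F t]) ω *
        ((Q[Z | F t]) ω - (P[Z | F t]) ω)| ≤
      C * (P[fun ω => |(P[fun ω => (Q.rnDeriv P ω).toReal | ⨆ t, F t]) ω -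
        (P[fun ω => (Q.rnDeriv P ω).toReal | F t]) ω| | F t]) ω := by
  have hle : ⨆ t, F t ≤ m0 := iSup_le fun t => F.le t
  have hZ0 : Measurable[m0] Z := hZ.mono hle le_rfl
  set Λ : Ω → ℝ := fun ω => (Q.rnDeriv P ω).toReal with hΛdef
  have hΛ : Integrable Λ P := Measure.integrable_toReal_rnDeriv
  have hZP : Integrable Z P := .of_bound hZ0.aestronglyMeasurable C (Eventually.of_forall hC)
  have hbdd : ∀ {f : Ω → ℝ}, Integrable f P → Integrable (fun ω => f ω * Z ω) P := fun hf =>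
    hf.mul_bdd (c := C) hZ0.aestronglyMeasurable (Eventually.of_forall hC)
  have hA := condExp_rnDeriv_mul hQP (F.le t) hZ0 hC
  have hB : P[fun ω => Λ ω * Z ω | F t] =ᵐ[P]
      P[fun ω => (P[Λ | ⨆ t, F t]) ω * Z ω | F t] := by
    refine (condExp_condExp_of_le (le_iSup (fun t => F t) t) hle).symm.trans ?_
    exact condExp_congr_ae (condExp_mul_of_stronglyMeasurable_right hZ.stronglyMeasurable
      (hbdd hΛ) hΛ)
  have hD : P[fun ω => (P[Λ | F t]) ω * Z ω | F t] =ᵐ[P] P[Λ | F t] * P[Z | F t] :=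
    condExp_mul_of_stronglyMeasurable_left stronglyMeasurable_condExp (hbdd integrable_condExp) hZP
  have hE := condExp_sub (m := F t) (hbdd (integrable_condExp (f := Λ) (m := ⨆ t, F t)))
    (hbdd (integrable_condExp (f := Λ) (m := F t)))
  have hEabs := abs_condExp_ae_le_condExp_abs (μ := P) (m := F t)
    ((fun ω => (P[Λ | ⨆ t, F t]) ω * Z ω) - fun ω => (P[Λ | F t]) ω * Z ω)
  have hdiff : Integrable (fun ω => |(P[Λ | ⨆ t, F t]) ω - (P[Λ | F t]) ω|) P :=
    (integrable_condExp.sub integrable_condExp).abs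
  have hmono : P[abs ((fun ω => (P[Λ | ⨆ t, F t]) ω * Z ω) - fun ω => (P[Λ | F t]) ω * Z ω) | F t]
      ≤ᵐ[P] P[C • fun ω => |(P[Λ | ⨆ t, F t]) ω - (P[Λ | F t]) ω| | F t] := by
    refine condExp_mono ((hbdd integrable_condExp).sub (hbdd integrable_condExp)).abs
      (hdiff.smul C) (Eventually.of_forall fun ω => ?_)
    simp only [Pi.abs_apply, Pi.sub_apply, Pi.smul_apply, smul_eq_mul, ← sub_mul, abs_mul]
    rw [mul_comm C]
    exact mul_le_mul_of_nonneg_left (hC ω) (abs_nonneg _)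
  have hsm := condExp_smul (μ := P) C (fun ω => |(P[Λ | ⨆ t, F t]) ω - (P[Λ | F t]) ω|) (F t)
  filter_upwards [hA, hQP.ae_le hB, hQP.ae_le hD, hQP.ae_le hE, hQP.ae_le hEabs,
    hQP.ae_le hmono, hQP.ae_le hsm] with ω a b d e f g h
  rw [h] at g
  simp only [Pi.sub_apply, Pi.mul_apply, Pi.abs_apply, Pi.smul_apply, smul_eq_mul] at *
  rw [mul_sub, a, b, ← d, ← e]
  exact f.trans g

/-- Conditioning Λ_∞ - Λ_k on F_t gives Λ_t - Λ_k, so the first bound is conditional Jensen and the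
second follows by the triangle inequality. This trades the moving index t for a fixed k, so that the
maximal inequality can be applied to a single closed martingale. -/
theorem ae_condExp_abs_sub_le [IsProbabilityMeasure P] (F : Filtration ℝ≥0 m0) (g : Ω → ℝ)
    {k t : ℝ≥0} (hkt : k ≤ t) :
    ∀ᵐ ω ∂P, |(P[g | F k]) ω - (P[g | F t]) ω| ≤
        (P[fun ω => |(P[g | ⨆ t, F t]) ω - (P[g | F k]) ω| | F t]) ω ∧
      (P[fun ω => |(P[g | ⨆ t, F t]) ω - (P[g | F t]) ω| | F t]) ω ≤
        2 * (P[fun ω => |(P[g | ⨆ t, F t]) ω - (P[g | F k]) ω| | F t]) ω := by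
  have hle : ⨆ t, F t ≤ m0 := iSup_le fun t => F.le t
  set W : Ω → ℝ := fun ω => |(P[g | ⨆ t, F t]) ω - (P[g | F k]) ω| with hW
  have hWi : Integrable W P := (integrable_condExp.sub integrable_condExp).abs
  have h1 : P[P[g | ⨆ t, F t] | F t] =ᵐ[P] P[g | F t] :=
    condExp_condExp_of_le (le_iSup (fun t => F t) t) hle
  have h2 : P[P[g | F k] | F t] = P[g | F k] :=
    condExp_of_stronglyMeasurable (F.le t) (stronglyMeasurable_condExp.mono (F.mono hkt))
      integrable_condExp
  have h3 := condExp_sub (m := F t) (integrable_condExp (μ := P) (f := g) (m := ⨆ t, F t))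
    (integrable_condExp (μ := P) (f := g) (m := F k))
  have h4 := abs_condExp_ae_le_condExp_abs (μ := P) (m := F t) (P[g | ⨆ t, F t] - P[g | F k])
  have hA : ∀ᵐ ω ∂P, |(P[g | F k]) ω - (P[g | F t]) ω| ≤ (P[W | F t]) ω := by
    filter_upwards [h1, h3, h4] with ω a b c
    rw [Pi.abs_apply, b, Pi.sub_apply, a, h2, abs_sub_comm] at c
    exact c
  have h5 : P[fun ω => |(P[g | ⨆ t, F t]) ω - (P[g | F t]) ω| | F t] ≤ᵐ[P]
      P[W + P[W | F t] | F t] := by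
    refine condExp_mono (integrable_condExp.sub integrable_condExp).abs
      (hWi.add integrable_condExp) ?_
    filter_upwards [hA] with ω hω
    rw [Pi.add_apply]
    exact (abs_sub_le _ ((P[g | F k]) ω) _).trans (by gcongr)
  have h6 := condExp_add (m := F t) hWi (integrable_condExp (μ := P) (f := W) (m := F t))
  have h7 : P[P[W | F t] | F t] = P[W | F t] :=
    condExp_of_stronglyMeasurable (F.le t) stronglyMeasurable_condExp integrable_condExp
  filter_upwards [hA, h5, h6] with ω a b c
  refine ⟨a, b.trans ?_⟩
  rw [c, Pi.add_apply, h7, two_mul]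

/-- The Blackwell–Dubins merging of opinions along the dyadic times: for `Q ≪ P` and uniformly
bounded `Z t` which are measurable with respect to the terminal σ-algebra, the conditional
expectations of `Z t` given `F t` under `Q` and `P` merge, `Q`-almost surely. -/
theorem ae_tendsto_condExp_sub_condExp [IsProbabilityMeasure P] [IsProbabilityMeasure Q]
    (hQP : Q ≪ P) (F : Filtration ℝ≥0 m0) {Z : ℝ≥0 → Ω → ℝ}
    (hZ : ∀ t, Measurable[⨆ t, F t] (Z t)) {C : ℝ} (hC : ∀ t ω, |Z t ω| ≤ C) :
    ∀ᵐ ω ∂Q, Tendsto (fun t => (Q[Z t | F t]) ω - (P[Z t | F t]) ω)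
      (atTop ⊓ 𝓟 dyadics) (𝓝 0) := by
  set Λ : Ω → ℝ := fun ω => (Q.rnDeriv P ω).toReal with hΛdef
  have hC0 : 0 ≤ C := by
    obtain ⟨ω⟩ : Nonempty Ω := nonempty_of_isProbabilityMeasure P
    exact (abs_nonneg _).trans (hC 0 ω)
  have h1 : ∀ᵐ ω ∂Q, ∀ t ∈ dyadics, |(P[Λ | F t]) ω * ((Q[Z t | F t]) ω - (P[Z t | F t]) ω)| ≤
      C * (P[fun ω => |(P[Λ | ⨆ t, F t]) ω - (P[Λ | F t]) ω| | F t]) ω :=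
    (ae_ball_iff countable_dyadics).2 fun t _ =>
      ae_condExp_rnDeriv_mul_sub_le hQP F (hZ t) (hC t) t
  have h2 : ∀ᵐ ω ∂Q, ∀ k : ℕ, ∀ t ∈ dyadics, (k : ℝ≥0) ≤ t →
      |(P[Λ | F k]) ω - (P[Λ | F t]) ω| ≤
        (P[fun ω => |(P[Λ | ⨆ t, F t]) ω - (P[Λ | F k]) ω| | F t]) ω ∧
      (P[fun ω => |(P[Λ | ⨆ t, F t]) ω - (P[Λ | F t]) ω| | F t]) ω ≤
        2 * (P[fun ω => |(P[Λ | ⨆ t, F t]) ω - (P[Λ | F k]) ω| | F t]) ω := by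
    refine ae_all_iff.2 fun k => (ae_ball_iff countable_dyadics).2 fun t _ => ?_
    by_cases hkt : (k : ℝ≥0) ≤ t
    · filter_upwards [hQP.ae_le (ae_condExp_abs_sub_le F Λ hkt)] with ω hω _ using hω
    · exact Eventually.of_forall fun ω h => absurd h hkt
  have hb : ∀ (μ : Measure Ω), Q ≪ μ → ∀ᵐ ω ∂Q, ∀ t ∈ dyadics, |(μ[Z t | F t]) ω| ≤ C :=
    fun μ hμ => (ae_ball_iff countable_dyadics).2 fun t _ =>
      hμ.ae_le (ae_bdd_abs_condExp_of_ae_bdd_abs (Eventually.of_forall (hC t)))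
  filter_upwards [h1, h2, hb Q .rfl, hb P hQP,
    hQP.ae_le (ae_exists_forall_condExp_abs_sub_lt F Λ),
    ae_pos_condExp_rnDeriv hQP (iSup_le fun t => F.le t)] with ω a b c d e hpos
  -- The weight is the terminal density rather than the one at time t: it is constant in t and
  -- positive, hence can be cancelled in the limit.
  have key : Tendsto (fun t => (P[Λ | ⨆ t, F t]) ω * ((Q[Z t | F t]) ω - (P[Z t | F t]) ω))
      (atTop ⊓ 𝓟 dyadics) (𝓝 0) := by
    rw [Metric.tendsto_nhds]
    intro ε hε
    -- The total error is 2Cδ from the weighted bound plus 2δ · 2C from replacing the weight, that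
    -- is 6Cδ. The added 1 keeps the denominator positive when C = 0.
    obtain ⟨k, hk1, hk2⟩ := e (ε / (6 * C + 1)) (by positivity)
    rw [eventually_inf_principal]
    filter_upwards [eventually_ge_atTop (k : ℝ≥0)] with t hkt ht
    obtain ⟨b1, b2⟩ := b k t ht hkt
    have a' := a t ht
    have c' := abs_le.1 (c t ht)
    have d' := abs_le.1 (d t ht)
    have k2 := hk2 t ht
    set δ := ε / (6 * C + 1) with hδ
    set x := (Q[Z t | F t]) ω - (P[Z t | F t]) ω
    have hx : |x| ≤ 2 * C := abs_le.2 ⟨by linarith [c'.1, d'.2], by linarith [c'.2, d'.1]⟩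
    have hL : |(P[Λ | ⨆ t, F t]) ω - (P[Λ | F t]) ω| ≤ 2 * δ :=
      (abs_sub_le _ ((P[Λ | F k]) ω) _).trans (by linarith)
    rw [Real.dist_eq, sub_zero]
    have hδ0 : 0 < δ := by positivity
    have e1 : (P[Λ | ⨆ t, F t]) ω * x = (P[Λ | F t]) ω * x +
        ((P[Λ | ⨆ t, F t]) ω - (P[Λ | F t]) ω) * x := by ring
    calc |(P[Λ | ⨆ t, F t]) ω * x| ≤ |(P[Λ | F t]) ω * x| +
        |(P[Λ | ⨆ t, F t]) ω - (P[Λ | F t]) ω| * |x| := by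
          rw [e1, ← abs_mul]; exact abs_add_le _ _
      _ ≤ C * (2 * δ) + 2 * δ * (2 * C) := by
          gcongr
          exact a'.trans (by gcongr; linarith)
      _ = 6 * C * δ := by ring
      _ < ε := by
          rw [hδ, mul_div_assoc', div_lt_iff₀ (by positivity)]
          nlinarith
  have hne : (P[Λ | ⨆ t, F t]) ω ≠ 0 := hpos.ne'
  have := key.const_mul ((P[Λ | ⨆ t, F t]) ω)⁻¹
  simpa [← mul_assoc, inv_mul_cancel₀ hne] using this

end Discretization
end FilterStability

/-! ### Regularization along dyadic times and upcrossings. -/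

namespace FilterStability

/-- The function `x` has right and left limits along the dyadic rationals at every time. -/
def HasDyadicLimits (x : ℝ≥0 → ℝ) : Prop :=
  ∀ t, (∃ l, Tendsto x (𝓝[dyadics ∩ Set.Ioi t] t) (𝓝 l)) ∧
    ∃ l, Tendsto x (𝓝[dyadics ∩ Set.Iio t] t) (𝓝 l)

/-- The right limit at `t` of `x` along the dyadic rationals. -/
noncomputable def rightDyadicLim (x : ℝ≥0 → ℝ) (t : ℝ≥0) : ℝ :=
  limUnder (𝓝[dyadics ∩ Set.Ioi t] t) x

theorem HasDyadicLimits.tendsto_rightDyadicLim {x : ℝ≥0 → ℝ} (h : HasDyadicLimits x) (t : ℝ≥0) :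
    Tendsto x (𝓝[dyadics ∩ Set.Ioi t] t) (𝓝 (rightDyadicLim x t)) :=
  tendsto_nhds_limUnder (h t).1

theorem HasDyadicLimits.isCadlag_rightDyadicLim {x : ℝ≥0 → ℝ} (h : HasDyadicLimits x) :
    IsCadlag (rightDyadicLim x) := by
  -- Each regularized value at s is a limit of dyadic values arbitrarily near s. If s lies in an
  -- open set where the dyadic values stay in a closed neighbourhood of l, the regularized value
  -- stays there too. Taking G on either side of t gives both halves of the càdlàg property.
  have key : ∀ (G : Set ℝ≥0) (t : ℝ≥0) (l : ℝ), IsOpen G →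
      Tendsto x (𝓝[dyadics ∩ G] t) (𝓝 l) → Tendsto (rightDyadicLim x) (𝓝[G] t) (𝓝 l) := by
    intro G t l hG hx
    refine (closed_nhds_basis l).tendsto_right_iff.2 fun V ⟨hV, hVc⟩ => ?_
    obtain ⟨U, hU, htU, hsub⟩ := mem_nhdsWithin.1 (hx hV)
    refine mem_nhdsWithin.2 ⟨U, hU, htU, fun s hs => ?_⟩
    refine hVc.mem_of_tendsto (h.tendsto_rightDyadicLim s) ?_
    have : U ∩ G ∈ 𝓝 s := (hU.inter hG).mem_nhds hs
    filter_upwards [mem_nhdsWithin_of_mem_nhds this, self_mem_nhdsWithin] with r hr hr'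
    exact hsub ⟨hr.1, hr'.1, hr.2⟩
  intro t
  refine ⟨?_, ?_⟩
  · rw [← continuousWithinAt_Ioi_iff_Ici]
    exact key _ t _ isOpen_Ioi (h.tendsto_rightDyadicLim t)
  · obtain ⟨l, hl⟩ := (h t).2
    exact ⟨l, key _ t l isOpen_Iio hl⟩

/-- Uniform approximation on the dyadics preserves the Cauchy property along each one-sided filter.
The trivial filter must be allowed, since there is nothing to the left of 0. -/
theorem HasDyadicLimits.of_approx {x : ℝ≥0 → ℝ}
    (h : ∀ ε > 0, ∃ x', HasDyadicLimits x' ∧ ∀ t ∈ dyadics, |x t - x' t| ≤ ε) :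
    HasDyadicLimits x := by
  have key : ∀ l : Filter ℝ≥0, l ≤ 𝓟 dyadics →
      (∀ x', HasDyadicLimits x' → ∃ c, Tendsto x' l (𝓝 c)) → ∃ c, Tendsto x l (𝓝 c) := by
    intro l hl hlim
    rcases l.eq_or_neBot with rfl | hne
    · exact ⟨0, tendsto_bot⟩
    refine CompleteSpace.complete (Metric.cauchy_iff.2 ⟨inferInstance, fun ε hε => ?_⟩)
    obtain ⟨x', hx', happ⟩ := h (ε / 4) (by positivity)
    obtain ⟨c, hc⟩ := hlim x' hx'
    refine ⟨Metric.ball c (ε / 2), ?_, fun a ha b hb => ?_⟩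
    · rw [mem_map]
      filter_upwards [hl (mem_principal_self _), Metric.tendsto_nhds.1 hc (ε / 4) (by positivity)]
        with t ht hd
      have := happ t ht
      rw [← Real.dist_eq] at this
      exact (dist_triangle _ (x' t) _).trans_lt (by linarith)
    · exact (dist_triangle_right _ _ c).trans_lt (by
        rw [Metric.mem_ball] at ha hb; linarith)
  intro t
  exact ⟨key _ (le_principal_iff.2 (mem_of_superset self_mem_nhdsWithin Set.inter_subset_left))
      fun x' hx' => (hx' t).1,
    key _ (le_principal_iff.2 (mem_of_superset self_mem_nhdsWithin Set.inter_subset_left))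
      fun x' hx' => (hx' t).2⟩

theorem HasDyadicLimits.sub_continuous {x y : ℝ≥0 → ℝ} (h : HasDyadicLimits x)
    (hy : Continuous y) : HasDyadicLimits fun t => x t - y t := by
  intro t
  obtain ⟨⟨l, hl⟩, ⟨l', hl'⟩⟩ := h t
  exact ⟨⟨_, hl.sub (hy.continuousAt.tendsto.mono_left nhdsWithin_le_nhds)⟩,
    ⟨_, hl'.sub (hy.continuousAt.tendsto.mono_left nhdsWithin_le_nhds)⟩⟩

/-- `Zigzag x a b N K s` means that `x` has `K` successive upcrossings of `[a, b]` at dyadic times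
strictly between `s` and `N`. -/
def Zigzag (x : ℝ≥0 → ℝ) (a b : ℝ) (N : ℝ≥0) : ℕ → ℝ≥0 → Prop
  | 0, s => s < N
  | K + 1, s => ∃ q ∈ dyadics, ∃ r ∈ dyadics, s < q ∧ q < r ∧ x q < a ∧ b < x r ∧
      Zigzag x a b N K r

theorem exists_forall_ge_eq_div {q : ℝ≥0} (hq : q ∈ dyadics) :
    ∃ n₀ : ℕ, ∀ n ≥ n₀, ∃ k : ℕ, q = k / 2 ^ n := by
  obtain ⟨n₀, hn₀⟩ := Set.mem_iUnion.1 hq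
  refine ⟨n₀, fun n hn => ?_⟩
  obtain ⟨k, -, h⟩ := dyadicGrid_mono hn hn₀
  exact ⟨k, h⟩

/-- Finitely many dyadic times lie on every sufficiently fine grid, so the discrete count eventually
sees all K crossings. The slack `+ 1` in the bound on `M` is needed because a crossing ending at
index j is counted only before j + 1, from where the induction resumes. -/
theorem Zigzag.eventually_le_upcrossingsBefore {Ω : Type*} {z : ℝ≥0 → Ω → ℝ} {ω : Ω} {a b : ℝ}
    (hab : a < b) {N : ℕ} (K : ℕ) (s : ℝ≥0) (h : Zigzag (fun t => z t ω) a b N K s) :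
    ∃ n₀ : ℕ, ∀ n ≥ n₀, ∀ M : ℕ, (M : ℝ≥0) ≤ s * 2 ^ n + 1 →
      upcrossingsBefore a b (fun k : ℕ => z (k / 2 ^ n)) M ω + K ≤
        upcrossingsBefore a b (fun k : ℕ => z (k / 2 ^ n)) (N * 2 ^ n) ω := by
  induction K generalizing s with
  | zero =>
    have hs : s < N := h
    have hs' : (0 : ℝ) < N - s := sub_pos.2 (by exact_mod_cast hs)
    obtain ⟨n₀, hn₀⟩ := exists_nat_gt (1 / ((N : ℝ) - s))
    refine ⟨n₀, fun n hn M hM => ?_⟩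
    refine upcrossingsBefore_mono hab ?_ ω
    have hM' : (M : ℝ) ≤ s * 2 ^ n + 1 := by exact_mod_cast hM
    have h1 : (n₀ : ℝ) ≤ 2 ^ n := by exact_mod_cast hn.trans Nat.lt_two_pow_self.le
    rw [div_lt_iff₀ hs'] at hn₀
    have : (M : ℝ) ≤ N * 2 ^ n := by nlinarith
    exact_mod_cast this
  | succ K ih =>
    obtain ⟨q, hq, r, hr, hsq, hqr, hxq, hxr, hz⟩ := h
    obtain ⟨n₁, h₁⟩ := exists_forall_ge_eq_div hq
    obtain ⟨n₂, h₂⟩ := exists_forall_ge_eq_div hr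
    obtain ⟨n₃, h₃⟩ := ih r hz
    refine ⟨max n₁ (max n₂ n₃), fun n hn M hM => ?_⟩
    simp only [ge_iff_le, max_le_iff] at hn
    obtain ⟨i, rfl⟩ := h₁ n hn.1
    obtain ⟨j, rfl⟩ := h₂ n hn.2.1
    have hp : (0 : ℝ≥0) < 2 ^ n := by positivity
    have hMi : M ≤ i := by
      rw [lt_div_iff₀ hp] at hsq
      have : (M : ℝ≥0) < i + 1 := hM.trans_lt (by gcongr)
      exact Nat.lt_succ_iff.1 (by exact_mod_cast this)
    have hij : i ≤ j := by
      rw [div_lt_div_iff_of_pos_right hp] at hqr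
      exact_mod_cast hqr.le
    have h4 := upcrossingsBefore_lt_of_exists_upcrossing (f := fun k : ℕ => z (k / 2 ^ n)) (ω := ω)
      hab hMi hxq hij hxr
    have h5 := h₃ n hn.2.2 (j + 1) (by rw [div_mul_cancel₀ _ hp.ne']; push_cast; rfl)
    omega

theorem zigzag_of_frequently_Ioi {x : ℝ≥0 → ℝ} {a b : ℝ} {t N : ℝ≥0} (ht : t < N)
    (ha : ∃ᶠ s in 𝓝[dyadics ∩ Set.Ioi t] t, x s < a)
    (hb : ∃ᶠ s in 𝓝[dyadics ∩ Set.Ioi t] t, b < x s) (K : ℕ) : Zigzag x a b N K t := by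
  have find : ∀ {p : ℝ≥0 → Prop}, (∃ᶠ s in 𝓝[dyadics ∩ Set.Ioi t] t, p s) → ∀ v > t,
      ∃ q ∈ dyadics, t < q ∧ q < v ∧ p q := by
    intro p hp v hv
    obtain ⟨q, hpq, hq, hqv⟩ := (hp.and_eventually (inter_mem self_mem_nhdsWithin
      (mem_nhdsWithin_of_mem_nhds (Iio_mem_nhds hv)))).exists
    exact ⟨q, hq.1, hq.2, hqv, hpq⟩
  -- Oscillation accumulates at t from the right, so crossings are found backwards in time: each new
  -- one is squeezed between t and those already present. The statement is strengthened to all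
  -- starting points below some v > t to leave that room.
  suffices ∃ v > t, ∀ r < v, Zigzag x a b N K r by
    obtain ⟨v, hv, h⟩ := this; exact h t hv
  induction K with
  | zero => exact ⟨N, ht, fun r hr => hr⟩
  | succ K ih =>
    obtain ⟨v, hv, h⟩ := ih
    obtain ⟨r, hr, htr, hrv, hxr⟩ := find hb v hv
    obtain ⟨q, hq, htq, hqr, hxq⟩ := find ha r htr
    exact ⟨q, htq, fun s hs => ⟨q, hq, r, hr, hs, hqr, hxq, hxr, h r hrv⟩⟩

theorem zigzag_of_frequently_Iio {x : ℝ≥0 → ℝ} {a b : ℝ} {t N : ℝ≥0} (ht : t < N)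
    (ha : ∃ᶠ s in 𝓝[dyadics ∩ Set.Iio t] t, x s < a)
    (hb : ∃ᶠ s in 𝓝[dyadics ∩ Set.Iio t] t, b < x s) (K : ℕ) :
    ∀ u < t, Zigzag x a b N K u := by
  have find : ∀ {p : ℝ≥0 → Prop}, (∃ᶠ s in 𝓝[dyadics ∩ Set.Iio t] t, p s) → ∀ v < t,
      ∃ q ∈ dyadics, v < q ∧ q < t ∧ p q := by
    intro p hp v hv
    obtain ⟨q, hpq, hq, hqv⟩ := (hp.and_eventually (inter_mem self_mem_nhdsWithin
      (mem_nhdsWithin_of_mem_nhds (Ioi_mem_nhds hv)))).exists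
    exact ⟨q, hq.1, hqv, hq.2, hpq⟩
  induction K with
  | zero => exact fun u hu => hu.trans ht
  | succ K ih =>
    intro u hu
    obtain ⟨q, hq, huq, hqt, hxq⟩ := find ha u hu
    obtain ⟨r, hr, hqr, hrt, hxr⟩ := find hb q hqt
    exact ⟨q, hq, r, hr, huq, hqr, hxq, hxr, ih r hrt⟩

section Submartingale

variable {Ω : Type*} {m0 : MeasurableSpace Ω} {P : Measure Ω}

theorem Submartingale.sampled {F : Filtration ℝ≥0 m0} {z : ℝ≥0 → Ω → ℝ} (hz : Submartingale z F P)
    (n : ℕ) : Submartingale (fun k : ℕ => z (k / 2 ^ n)) (sampledFiltration F n) P :=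
  ⟨fun k => hz.1 _, fun i j hij => hz.2.1 _ _ (by gcongr), fun k => hz.2.2 _⟩

/-- All sampled processes end at the same time N, so Doob's upcrossing inequality bounds the
expected counts uniformly in the mesh; Fatou does the rest. -/
theorem ae_liminf_upcrossingsBefore_lt_top [IsFiniteMeasure P] {F : Filtration ℝ≥0 m0}
    {z : ℝ≥0 → Ω → ℝ} (hz : Submartingale z F P) {a b : ℝ} (hab : a < b) (N : ℕ) :
    ∀ᵐ ω ∂P, liminf (fun n : ℕ => (upcrossingsBefore a b (fun k : ℕ => z (k / 2 ^ n))
      (N * 2 ^ n) ω : ENNReal)) atTop < ⊤ := by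
  have hmeas : ∀ n : ℕ, Measurable fun ω => (upcrossingsBefore a b (fun k : ℕ => z (k / 2 ^ n))
      (N * 2 ^ n) ω : ENNReal) := fun n => measurable_from_top.comp
    ((Submartingale.sampled hz n).stronglyAdapted.measurable_upcrossingsBefore hab)
  refine ae_lt_top (Measurable.liminf hmeas) ?_
  refine ((lintegral_liminf_le hmeas).trans_lt ?_).ne
  refine lt_of_le_of_lt (liminf_le_of_frequently_le' (x := ENNReal.ofReal
    ((∫ ω, (z N ω - a)⁺ ∂P) / (b - a))) (Frequently.of_forall fun n => ?_)) ENNReal.ofReal_lt_top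
  have h1 := (Submartingale.sampled hz n).mul_integral_upcrossingsBefore_le_integral_pos_part a b
    (N * 2 ^ n)
  have h2 : (((N * 2 ^ n : ℕ) : ℝ≥0) / 2 ^ n) = N := by push_cast; field_simp
  rw [h2, mul_comm, ← le_div_iff₀ (sub_pos.2 hab)] at h1
  refine le_trans (le_of_eq ?_) (ENNReal.ofReal_le_ofReal h1)
  rw [ofReal_integral_eq_lintegral_ofReal
    ((Submartingale.sampled hz n).stronglyAdapted.integrable_upcrossingsBefore hab)
    (Eventually.of_forall fun ω => by positivity)]
  simp

/-- A locally bounded submartingale has one-sided limits along the dyadic times, almost surely. -/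
theorem ae_hasDyadicLimits_of_submartingale [IsFiniteMeasure P] {F : Filtration ℝ≥0 m0}
    {z : ℝ≥0 → Ω → ℝ} (hz : Submartingale z F P)
    (hbdd : ∀ N : ℕ, ∃ K : ℝ, ∀ t ≤ (N : ℝ≥0), ∀ᵐ ω ∂P, |z t ω| ≤ K) :
    ∀ᵐ ω ∂P, HasDyadicLimits fun t => z t ω := by
  choose K hK using hbdd
  have h1 : ∀ᵐ ω ∂P, ∀ t ∈ dyadics, ∀ N : ℕ, t ≤ (N : ℝ≥0) → |z t ω| ≤ K N :=
    (ae_ball_iff countable_dyadics).2 fun t _ => ae_all_iff.2 fun N => by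
      by_cases h : t ≤ (N : ℝ≥0)
      · filter_upwards [hK N t h] with ω hω _ using hω
      · exact Eventually.of_forall fun ω h' => absurd h' h
  have h2 : ∀ᵐ ω ∂P, ∀ a b : ℚ, a < b → ∀ N : ℕ,
      liminf (fun n : ℕ => (upcrossingsBefore (a : ℝ) b (fun k : ℕ => z (k / 2 ^ n))
        (N * 2 ^ n) ω : ENNReal)) atTop < ⊤ := by
    refine ae_all_iff.2 fun a => ae_all_iff.2 fun b => ?_
    by_cases hab : a < b
    · filter_upwards [ae_all_iff.2 fun N => ae_liminf_upcrossingsBefore_lt_top hz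
        (Rat.cast_lt (K := ℝ).2 hab) N] with ω hω _ using hω
    · exact Eventually.of_forall fun ω h' => absurd h' hab
  filter_upwards [h1, h2] with ω hb hu
  -- The starting point may vary with K. Only finiteness of the liminf of the counts is needed to
  -- exclude arbitrarily many crossings.
  have nozig : ∀ a b : ℚ, a < b → ∀ (N : ℕ) (s : ℕ → ℝ≥0),
      ¬ ∀ K, Zigzag (fun t => z t ω) a b N K (s K) := by
    intro a b hab N s hzig
    refine (hu a b hab N).ne (ENNReal.eq_top_of_forall_nnreal_le fun r => ?_)
    obtain ⟨k, hk⟩ := exists_nat_ge r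
    obtain ⟨n₀, hn₀⟩ := (hzig k).eventually_le_upcrossingsBefore (Rat.cast_lt (K := ℝ).2 hab)
    refine le_liminf_of_le (by isBoundedDefault) ?_
    filter_upwards [eventually_ge_atTop n₀] with n hn
    have := hn₀ n hn 0 (by simp)
    rw [upcrossingsBefore_zero, zero_add] at this
    calc (r : ENNReal) ≤ (k : ENNReal) := by exact_mod_cast hk
      _ ≤ _ := by exact_mod_cast this
  have bdd : ∀ (l : Filter ℝ≥0) (t : ℝ≥0), l ≤ 𝓝 t → l ≤ 𝓟 dyadics →
      IsBoundedUnder (· ≤ ·) l (fun s => z s ω) ∧ IsBoundedUnder (· ≥ ·) l (fun s => z s ω) := by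
    intro l t hl hD
    obtain ⟨N, hN⟩ := exists_nat_gt t
    have : ∀ᶠ s in l, |z s ω| ≤ K N := by
      filter_upwards [hl (Iio_mem_nhds hN), hD (mem_principal_self _)] with s hs hs'
      exact hb s hs' N (le_of_lt hs)
    exact ⟨⟨K N, by rw [eventually_map]; exact this.mono fun s hs => (abs_le.1 hs).2⟩,
      ⟨-K N, by rw [eventually_map]; exact this.mono fun s hs => (abs_le.1 hs).1⟩⟩
  intro t
  obtain ⟨N, hN⟩ := exists_nat_gt t
  constructor
  · obtain ⟨u1, u2⟩ := bdd (𝓝[dyadics ∩ Set.Ioi t] t) t nhdsWithin_le_nhds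
      (le_principal_iff.2 (mem_of_superset self_mem_nhdsWithin Set.inter_subset_left))
    refine tendsto_of_no_upcrossings Rat.denseRange_cast ?_ u1 u2
    rintro _ ⟨a, rfl⟩ _ ⟨b, rfl⟩ hab ⟨ha, hb'⟩
    exact nozig a b (by exact_mod_cast hab) N _ (zigzag_of_frequently_Ioi hN ha hb')
  · obtain ⟨u1, u2⟩ := bdd (𝓝[dyadics ∩ Set.Iio t] t) t nhdsWithin_le_nhds
      (le_principal_iff.2 (mem_of_superset self_mem_nhdsWithin Set.inter_subset_left))
    refine tendsto_of_no_upcrossings Rat.denseRange_cast ?_ u1 u2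
    rintro _ ⟨a, rfl⟩ _ ⟨b, rfl⟩ hab ⟨ha, hb'⟩
    have ht0 : ∃ u, u < t := by
      obtain ⟨q, -, hq⟩ := (ha.and_eventually self_mem_nhdsWithin).exists
      exact ⟨q, hq.2⟩
    obtain ⟨u, hu'⟩ := ht0
    exact nozig a b (by exact_mod_cast hab) N _ fun k => zigzag_of_frequently_Iio hN ha hb' k u hu'

end Submartingale
end FilterStability

/-! ### Density in C(S) by Hahn–Banach and Riesz representation. -/

namespace FilterStability
section Density

variable {S : Type*} [TopologicalSpace S] [CompactSpace S]

/-- A bounded linear functional on `C(S)` is a difference of two positive ones. -/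
theorem exists_nonneg_sub_nonneg [Nonempty S] (ℓ : C(S, ℝ) →L[ℝ] ℝ) :
    ∃ p q : C(S, ℝ) →ₗ[ℝ] ℝ, (∀ g, 0 ≤ g → 0 ≤ p g) ∧ (∀ g, 0 ≤ g → 0 ≤ q g) ∧
      ∀ g, ℓ g = p g - q g := by
  obtain ⟨x₀⟩ := ‹Nonempty S›
  -- On pairs (u, v) with constant sum, (ℓ(u - v) + ‖ℓ‖(u + v))/2 is nonnegative when u, v ≥ 0,
  -- since then ‖u - v‖ ≤ u + v. M. Riesz's theorem extends it positively to all pairs; its two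
  -- coordinate restrictions are p and q, and the pair (g, -g), with sum 0, returns ℓ g = p g - q g.
  let W : Submodule ℝ (C(S, ℝ) × C(S, ℝ)) :=
    { carrier := {u | ∀ x, u.1 x + u.2 x = u.1 x₀ + u.2 x₀}
      add_mem' := fun {u v} hu hv x => by
        simp only [Set.mem_ofPred_eq, Prod.fst_add, Prod.snd_add, ContinuousMap.add_apply] at *
        linarith [hu x, hv x]
      zero_mem' := fun x => by simp
      smul_mem' := fun c u hu x => by
        simp only [Set.mem_ofPred_eq, Prod.smul_fst, Prod.smul_snd, ContinuousMap.smul_apply,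
          smul_eq_mul] at *
        rw [← mul_add, hu x, mul_add] }
  let L : C(S, ℝ) × C(S, ℝ) →ₗ[ℝ] ℝ :=
    { toFun := fun u => ℓ (u.1 - u.2) / 2 + ‖ℓ‖ * (u.1 x₀ + u.2 x₀) / 2
      map_add' := fun u v => by
        simp only [Prod.fst_add, Prod.snd_add, ContinuousMap.add_apply, map_sub, map_add]; ring
      map_smul' := fun c u => by
        simp only [Prod.smul_fst, Prod.smul_snd, ContinuousMap.smul_apply, map_sub, map_smul,
          smul_eq_mul, RingHom.id_apply]
        ring }
  let s : PointedCone ℝ (C(S, ℝ) × C(S, ℝ)) :=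
    { carrier := {u | (∀ x, 0 ≤ u.1 x) ∧ ∀ x, 0 ≤ u.2 x}
      add_mem' := fun {u v} hu hv =>
        ⟨fun x => add_nonneg (hu.1 x) (hv.1 x), fun x => add_nonneg (hu.2 x) (hv.2 x)⟩
      zero_mem' := ⟨fun x => le_rfl, fun x => le_rfl⟩
      smul_mem' := fun c u hu =>
        ⟨fun x => mul_nonneg c.2 (hu.1 x), fun x => mul_nonneg c.2 (hu.2 x)⟩ }
  obtain ⟨G, hG, hGs⟩ := riesz_extension s ⟨W, L.comp W.subtype⟩ (by
      rintro ⟨u, hu⟩ ⟨h1, h2⟩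
      have hu' : ∀ x, u.1 x + u.2 x = u.1 x₀ + u.2 x₀ := hu
      change 0 ≤ ℓ (u.1 - u.2) / 2 + ‖ℓ‖ * (u.1 x₀ + u.2 x₀) / 2
      have hn : ‖u.1 - u.2‖ ≤ u.1 x₀ + u.2 x₀ := by
        rw [ContinuousMap.norm_le _ (add_nonneg (h1 x₀) (h2 x₀))]
        intro x
        rw [Real.norm_eq_abs, abs_le, ContinuousMap.sub_apply]
        have a := h1 x
        have b := h2 x
        exact ⟨by linarith [hu' x], by linarith [hu' x]⟩
      have h3 := (abs_le.1 ((ℓ.le_opNorm (u.1 - u.2)).trans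
        (mul_le_mul_of_nonneg_left hn (norm_nonneg _)))).1
      linarith) (by
      -- A large constant pair belongs to `W` and moves any `y` into the cone.
      intro y
      refine ⟨⟨(ContinuousMap.const S (‖y.1‖ + ‖y.2‖), ContinuousMap.const S (‖y.1‖ + ‖y.2‖)),
        fun x => rfl⟩, fun x => ?_, fun x => ?_⟩
      · have := (abs_le.1 (y.1.norm_coe_le_norm x)).1
        simp only [Prod.fst_add, ContinuousMap.add_apply, ContinuousMap.const_apply]
        linarith [norm_nonneg y.2]
      · have := (abs_le.1 (y.2.norm_coe_le_norm x)).1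
        simp only [Prod.snd_add, ContinuousMap.add_apply, ContinuousMap.const_apply]
        linarith [norm_nonneg y.1])
  refine ⟨G.comp (LinearMap.inl ℝ _ _), G.comp (LinearMap.inr ℝ _ _),
    fun g hg => hGs _ ⟨fun x => hg x, fun x => le_rfl⟩,
    fun g hg => hGs _ ⟨fun x => le_rfl, fun x => hg x⟩, fun g => ?_⟩
  have hmem : ((g, -g) : C(S, ℝ) × C(S, ℝ)) ∈ W := fun x => by simp
  have h1 := hG ⟨(g, -g), hmem⟩
  have h2 : L (g, -g) = ℓ g := by
    change ℓ (g - -g) / 2 + ‖ℓ‖ * (g x₀ + (-g) x₀) / 2 = ℓ g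
    rw [map_sub, map_neg, ContinuousMap.neg_apply]; ring
  simp only [LinearMap.comp_apply, LinearMap.inl_apply, LinearMap.inr_apply]
  rw [← map_sub, ← h2]
  simp only [Prod.mk_sub_mk, sub_zero, zero_sub]
  exact h1.symm

variable [T2Space S] [MeasurableSpace S] [BorelSpace S]

theorem exists_measure_of_nonneg (p : C(S, ℝ) →ₗ[ℝ] ℝ) (hp : ∀ g, 0 ≤ g → 0 ≤ p g) :
    ∃ m : Measure S, IsFiniteMeasure m ∧ ∀ g : C(S, ℝ), ∫ x, g x ∂m = p g := by
  let Λ : CompactlySupportedContinuousMap S ℝ →ₚ[ℝ] ℝ :=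
    { toFun := fun g => p g.toContinuousMap
      map_add' := fun g g' => p.map_add _ _
      map_smul' := fun c g => p.map_smul _ _
      monotone' := fun g g' h => by
        have := hp (g'.toContinuousMap - g.toContinuousMap) (fun x => sub_nonneg.2 (h x))
        rw [map_sub] at this
        exact sub_nonneg.1 this }
  refine ⟨RealRMK.rieszMeasure Λ, inferInstance, fun g => ?_⟩
  exact RealRMK.integral_rieszMeasure Λ ⟨g, HasCompactSupport.of_compactSpace _⟩

/-- A subspace of `C(S)` which contains the constants and separates probability measures is
dense. -/
theorem dense_of_separates_probabilityMeasures [Nonempty S] (V : Submodule ℝ C(S, ℝ)) (h1 : 1 ∈ V)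
    (hV : ∀ μ ν : Measure S, IsProbabilityMeasure μ → IsProbabilityMeasure ν →
      (∀ g ∈ V, ∫ x, g x ∂μ = ∫ x, g x ∂ν) → μ = ν) :
    Dense (V : Set C(S, ℝ)) := by
  intro f
  by_contra hf
  obtain ⟨ℓ, u, hu, huf⟩ := geometric_hahn_banach_closed_point V.convex.closure isClosed_closure hf
  -- A linear functional bounded above on a subspace vanishes there.
  have hℓV : ∀ g ∈ V, ℓ g = 0 := by
    intro g hg
    have hb : ∀ c : ℝ, c * ℓ g < u := fun c => by
      have := hu (c • g) (subset_closure (V.smul_mem c hg))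
      simpa using this
    by_contra hne
    have := hb (u / ℓ g)
    rw [div_mul_cancel₀ _ hne] at this
    exact lt_irrefl _ this
  have hu0 : 0 < u := by simpa using hu 0 (subset_closure V.zero_mem)
  obtain ⟨p, q, hp, hq, hpq⟩ := exists_nonneg_sub_nonneg ℓ
  obtain ⟨m, hm, hmp⟩ := exists_measure_of_nonneg p hp
  obtain ⟨n, hn, hnq⟩ := exists_measure_of_nonneg q hq
  -- Since 1 ∈ V, the two positive parts have equal mass, so both normalize to probability measures
  -- by the same factor.
  have hmass : m.real Set.univ = n.real Set.univ := by
    have e1 := hmp 1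
    have e2 := hnq 1
    have e3 := hpq 1
    rw [hℓV 1 h1] at e3
    simp only [ContinuousMap.one_apply, integral_const, smul_eq_mul, mul_one] at e1 e2
    linarith
  have hmn : m = n := by
    by_cases h0 : m.real Set.univ = 0
    · have h0' := hmass ▸ h0
      rw [measureReal_eq_zero_iff, Measure.measure_univ_eq_zero] at h0 h0'
      rw [h0, h0']
    · have hc : ∀ k : Measure S, IsFiniteMeasure k → k.real Set.univ = m.real Set.univ →
          IsProbabilityMeasure ((k Set.univ)⁻¹ • k) := fun k hk h => by
        have : NeZero k := ⟨fun hk0 => h0 (by rw [← h, hk0]; simp)⟩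
        infer_instance
      have hmass' : m Set.univ = n Set.univ :=
        (measureReal_eq_measureReal_iff (by simp) (by simp)).1 hmass
      have h2 := hV _ _ (hc m hm rfl) (hc n hn hmass.symm) fun g hg => by
        rw [integral_smul_measure, integral_smul_measure, hmp, hnq, hmass']
        have := hpq g
        rw [hℓV g hg] at this
        rw [show p g = q g by linarith]
      have hm0 : m Set.univ ≠ 0 := fun h => h0 (by simp [measureReal_def, h])
      have h3 := congrArg (fun k => m Set.univ • k) h2
      simp only [← hmass', smul_smul, ENNReal.mul_inv_cancel hm0 (measure_ne_top _ _),
        one_smul] at h3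
      exact h3
  have : ℓ f = 0 := by rw [hpq f, ← hmp, ← hnq, hmn, sub_self]
  linarith

end Density
end FilterStability

/-! ### Canonical path space and the Markov property at finitely many times. -/

namespace FilterStability

theorem integral_bind_kernel {α β : Type*} {mα : MeasurableSpace α} {mβ : MeasurableSpace β}
    {m : Measure α} [SFinite m] {κ : Kernel α β} [IsSFiniteKernel κ] {f : β → ℝ}
    (hf : Integrable f (m.bind κ)) : ∫ b, f b ∂(m.bind κ) = ∫ a, ∫ b, f b ∂(κ a) ∂m := by
  have h : (κ ∘ₖ Kernel.const Unit m) () = m.bind κ := by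
    rw [Kernel.comp_apply, Kernel.const_apply]
  rw [← h] at hf ⊢
  rw [Kernel.integral_comp hf, Kernel.const_apply]

theorem abs_integral_le_of_bdd {α : Type*} {m : MeasurableSpace α} {μ : Measure α}
    [IsProbabilityMeasure μ] {f : α → ℝ} {C : ℝ} (hC : ∀ a, |f a| ≤ C) : |∫ a, f a ∂μ| ≤ C := by
  simpa using norm_integral_le_of_norm_le_const (μ := μ) (f := f) (C := C)
    (Eventually.of_forall hC)

section Paths

theorem IsCadlag.comp_add {E : Type*} [TopologicalSpace E] {x : ℝ≥0 → E} (hx : IsCadlag x)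
    (s : ℝ≥0) : IsCadlag fun t => x (s + t) := by
  intro t
  refine ⟨(hx (s + t)).1.comp (by fun_prop) fun u hu => by
    simpa using hu, ?_⟩
  obtain ⟨l, hl⟩ := (hx (s + t)).2
  refine ⟨l, hl.comp (tendsto_nhdsWithin_iff.2 ⟨?_, ?_⟩)⟩
  · exact (by fun_prop : Continuous fun u : ℝ≥0 => s + u).continuousAt.tendsto.mono_left
      nhdsWithin_le_nhds
  · filter_upwards [self_mem_nhdsWithin] with u hu
    simpa using hu

/-- The path shifted by time `s`. -/
def CadlagPath.shift {E : Type*} [TopologicalSpace E] (s : ℝ≥0) (x : CadlagPath E) :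
    CadlagPath E :=
  ⟨fun t => x.1 (s + t), x.2.comp_add s⟩

theorem CadlagPath.measurable_of_coord {α E : Type*} [TopologicalSpace E] [MeasurableSpace E]
    {mα : MeasurableSpace α} {f : α → CadlagPath E} (hf : ∀ t, Measurable fun a => (f a).1 t) :
    Measurable f := by
  rw [measurable_iff_comap_le]
  refine (MeasurableSpace.comap_iSup).trans_le (iSup_le fun t => ?_)
  rw [MeasurableSpace.comap_comp]
  exact (hf t).comap_le

variable {S : Type*} [TopologicalSpace S] {p : ℕ}

/-- The shift `θ_s` on the canonical space. -/
def pathShift (s : ℝ≥0) (ω : PathSpace S p) : PathSpace S p := (ω.1.shift s, ω.2.shift s)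

theorem XY_pathShift (s t : ℝ≥0) (ω : PathSpace S p) : XY t (pathShift s ω) = XY (s + t) ω := rfl

variable [MeasurableSpace S]

theorem measurable_pathShift (s : ℝ≥0) : Measurable (pathShift (S := S) (p := p) s) :=
  Measurable.prodMk
    (CadlagPath.measurable_of_coord fun t => measurable_X (S := S) (p := p) (s + t))
    (CadlagPath.measurable_of_coord fun t => measurable_Y (S := S) (p := p) (s + t))

theorem pathSpace_measurableSpace_eq :
    (inferInstance : MeasurableSpace (PathSpace S p)) =
      ⨆ t, MeasurableSpace.comap (XY t) inferInstance := by
  refine le_antisymm ?_ (iSup_le fun t => (measurable_XY t).comap_le)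
  refine sup_le ?_ ?_
  · refine (MeasurableSpace.comap_iSup).trans_le (iSup_mono fun t => ?_)
    rw [MeasurableSpace.comap_comp]
    exact (measurable_fst.comp (comap_measurable (XY (S := S) (p := p) t))).comap_le
  · refine (MeasurableSpace.comap_iSup).trans_le (iSup_mono fun t => ?_)
    rw [MeasurableSpace.comap_comp]
    exact (measurable_snd.comp (comap_measurable (XY (S := S) (p := p) t))).comap_le

/-- Measures agreeing on the finite-dimensional cylinders of a process agree on the σ-algebra it
generates. -/
theorem measure_eq_of_cylinders {Ω E : Type*} {mΩ : MeasurableSpace Ω} [MeasurableSpace E]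
    {μ ν : Measure Ω} [IsFiniteMeasure μ] [IsFiniteMeasure ν] {Z : ℝ≥0 → Ω → E}
    (hZ : ∀ t, Measurable (Z t))
    (h : ∀ (F : Finset ℝ≥0) (A : ℝ≥0 → Set E), (∀ t, MeasurableSet (A t)) →
      μ (⋂ t ∈ F, Z t ⁻¹' A t) = ν (⋂ t ∈ F, Z t ⁻¹' A t)) {B : Set Ω}
    (hB : MeasurableSet[⨆ t, MeasurableSpace.comap (Z t) inferInstance] B) : μ B = ν B := by
  classical
  let m : ℝ≥0 → MeasurableSpace Ω := fun t => MeasurableSpace.comap (Z t) inferInstance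
  have hgen : ⨆ t, m t = MeasurableSpace.generateFrom
      (piiUnionInter (fun t => {s | MeasurableSet[m t] s}) Set.univ) := by
    refine Eq.trans ?_ (generateFrom_piiUnionInter_measurableSet m Set.univ).symm
    simp
  refine ext_on_measurableSpace_of_generate_finite mΩ _ ?_
    (iSup_le fun t => (hZ t).comap_le) hgen
    (isPiSystem_piiUnionInter _ (fun t => @MeasurableSpace.isPiSystem_measurableSet Ω (m t)) _)
    ?_ hB
  · rintro _ ⟨F, -, f, hf, rfl⟩
    have : ∀ t, ∃ A : Set E, MeasurableSet A ∧ (t ∈ F → Z t ⁻¹' A = f t) := by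
      intro t
      by_cases ht : t ∈ F
      · obtain ⟨A, hA, hAf⟩ := hf t ht
        exact ⟨A, hA, fun _ => hAf⟩
      · exact ⟨∅, MeasurableSet.empty, fun h => absurd h ht⟩
    choose A hA hAf using this
    have e : ⋂ t ∈ F, f t = ⋂ t ∈ F, Z t ⁻¹' A t :=
      Set.iInter₂_congr fun t ht => (hAf t ht).symm
    rw [e]
    exact h F A hA
  · simpa using h ∅ (fun _ => Set.univ) fun _ => MeasurableSet.univ

theorem measure_pathSpace_ext {μ ν : Measure (PathSpace S p)} [IsFiniteMeasure μ]
    [IsFiniteMeasure ν]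
    (h : ∀ (F : Finset ℝ≥0) (A : ℝ≥0 → Set (S × Obs p)), (∀ t, MeasurableSet (A t)) →
      μ (⋂ t ∈ F, XY t ⁻¹' A t) = ν (⋂ t ∈ F, XY t ⁻¹' A t)) : μ = ν := by
  ext B hB
  refine measure_eq_of_cylinders measurable_XY h ?_
  rw [← pathSpace_measurableSpace_eq]
  exact hB

end Paths

section Markov

variable {S : Type*} [TopologicalSpace S] [MeasurableSpace S] {p : ℕ} (M : FilteringModel S p)

instance : IsMarkovKernel M.law := M.isMarkovKernel_law

instance (t : ℝ≥0) : IsMarkovKernel (M.trans t) := M.feller.isMarkov t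

theorem measurable_XY_fullFiltration {s t : ℝ≥0} (h : s ≤ t) :
    Measurable[fullFiltration S p t] (XY (S := S) (p := p) s) :=
  measurable_iff_comap_le.2
    (le_iSup₂ (f := fun s (_ : s ≤ t) => MeasurableSpace.comap (XY s) inferInstance) s h)

theorem measurable_Y_rawObsFiltration {s t : ℝ≥0} (h : s ≤ t) :
    Measurable[rawObsFiltration S p t] (Y (S := S) (p := p) s) :=
  measurable_iff_comap_le.2
    (le_iSup₂ (f := fun s (_ : s ≤ t) => MeasurableSpace.comap (Y s) inferInstance) s h)

theorem rawObsFiltration_le_fullFiltration (t : ℝ≥0) :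
    rawObsFiltration S p t ≤ fullFiltration S p t :=
  iSup₂_le fun _ hs => (measurable_snd.comp (measurable_XY_fullFiltration hs)).comap_le

/-- Integrating the indicator form of the Markov property over `B` turns it into an identity of
measures, which then applies to all bounded measurable functions at once. -/
theorem map_restrict_XY_add (z : S × Obs p) (s t : ℝ≥0) {B : Set (PathSpace S p)}
    (hB : MeasurableSet[fullFiltration S p s] B) :
    ((M.law z).restrict B).map (XY (s + t)) =
      (((M.law z).restrict B).map (XY s)).bind (M.trans t) := by
  have hB' := (fullFiltration S p).le s B hB
  ext A hA
  have hm : MeasurableSet (XY (S := S) (p := p) (s + t) ⁻¹' A) := measurable_XY _ hA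
  rw [Measure.map_apply (measurable_XY _) hA, Measure.restrict_apply hm,
    Measure.bind_apply hA (Kernel.aemeasurable _),
    lintegral_map (Kernel.measurable_coe _ hA) (measurable_XY _)]
  have h1 : ∫ ω in B, (XY (S := S) (p := p) (s + t) ⁻¹' A).indicator (fun _ => (1 : ℝ)) ω
      ∂(M.law z) = ∫ ω in B, (M.trans t (XY s ω)).real A ∂(M.law z) := by
    rw [← setIntegral_condExp ((fullFiltration S p).le s)
      ((integrable_const _).indicator hm) hB]
    exact integral_congr_ae (ae_restrict_of_ae (M.markov z s t A hA))
  rw [integral_indicator hm, Measure.restrict_restrict hm, setIntegral_const, smul_eq_mul,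
    mul_one, ] at h1
  have h2 : ∀ ω, M.trans t (XY s ω) A = ENNReal.ofReal ((M.trans t (XY s ω)).real A) :=
    fun ω => (ofReal_measureReal (measure_ne_top _ _)).symm
  simp_rw [h2]
  rw [← ofReal_integral_eq_lintegral_ofReal, ← h1, ofReal_measureReal (measure_ne_top _ _)]
  · refine Integrable.of_bound (C := 1) ?_ (Eventually.of_forall fun ω => ?_)
    · exact (((Kernel.measurable_coe _ hA).comp (measurable_XY s)).ennreal_toReal
        ).aestronglyMeasurable
    · rw [Real.norm_eq_abs, abs_of_nonneg measureReal_nonneg]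
      exact measureReal_le_one
  · exact Eventually.of_forall fun ω => measureReal_nonneg

theorem measurable_integral_trans (t : ℝ≥0) {k : S × Obs p → ℝ} (hk : Measurable k) :
    Measurable fun w => ∫ w', k w' ∂(M.trans t w) :=
  (hk.stronglyMeasurable.integral_kernel (κ := M.trans t)).measurable

theorem condExp_XY_add (z : S × Obs p) (s t : ℝ≥0) {k : S × Obs p → ℝ} (hk : Measurable k) {C : ℝ}
    (hC : ∀ w, |k w| ≤ C) :
    (M.law z)[fun ω => k (XY (s + t) ω) | fullFiltration S p s] =ᵐ[M.law z]
      fun ω => ∫ w, k w ∂(M.trans t (XY s ω)) := by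
  have hki : ∀ μ : Measure (S × Obs p), IsFiniteMeasure μ → Integrable k μ := fun μ hμ =>
    .of_bound hk.aestronglyMeasurable C (Eventually.of_forall hC)
  have hTm := measurable_integral_trans M t hk
  have hTs : Measurable[fullFiltration S p s] fun ω => ∫ w, k w ∂(M.trans t (XY s ω)) :=
    hTm.comp (measurable_XY_fullFiltration le_rfl)
  refine (ae_eq_condExp_of_forall_setIntegral_eq ((fullFiltration S p).le s) ?_ ?_ ?_
    hTs.stronglyMeasurable.aestronglyMeasurable).symm
  · exact .of_bound (hk.comp (measurable_XY _)).aestronglyMeasurable C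
      (Eventually.of_forall fun ω => hC _)
  · intro B _ _
    exact Integrable.of_bound (hTm.comp (measurable_XY _)).aestronglyMeasurable C
      (Eventually.of_forall fun ω => abs_integral_le_of_bdd hC)
  · intro B hB _
    have e := congrArg (fun μ => ∫ w, k w ∂μ) (map_restrict_XY_add M z s t hB)
    rw [integral_map (measurable_XY _).aemeasurable hk.aestronglyMeasurable,
      integral_bind_kernel (hki _ inferInstance),
      integral_map (measurable_XY _).aemeasurable hTm.aestronglyMeasurable] at e
    exact e.symm

/-- The Markov property for finitely many future times, with the dependence on the present state
continuous as soon as the transition kernels preserve bounded continuous functions. -/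
theorem exists_condExp_prod_XY
    (hT : ∀ t (k : S × Obs p → ℝ), Continuous k → Measurable k → (∃ C, ∀ w, |k w| ≤ C) →
      Continuous fun w => ∫ w', k w' ∂(M.trans t w))
    {h : ℝ≥0 → S × Obs p → ℝ} (hm : ∀ t, Measurable (h t)) (hb : ∀ t, ∃ C, ∀ w, |h t w| ≤ C)
    (F : Finset ℝ≥0) : ∀ u, (∀ t ∈ F, u ≤ t) → ∃ Φ : S × Obs p → ℝ, Measurable Φ ∧
      (∃ C, ∀ w, |Φ w| ≤ C) ∧ ((∀ t, Continuous (h t)) → Continuous Φ) ∧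
      ∀ z s, (M.law z)[fun ω => ∏ t ∈ F, h t (XY (s + t) ω) | fullFiltration S p (s + u)]
        =ᵐ[M.law z] fun ω => Φ (XY (s + u) ω) := by
  -- Peel off the earliest time a: conditioning at s + a replaces the later factors by Φ, and the
  -- transition kernel over a - u brings the product back to time s + u.
  induction F using Finset.induction_on_min with
  | empty =>
    refine fun u _ => ⟨fun _ => 1, measurable_const, ⟨1, by simp⟩, fun _ => continuous_const,
      fun z s => ?_⟩
    exact (condExp_const (μ := M.law z) ((fullFiltration S p).le _) (1 : ℝ)).eventuallyEq
  | insert a F ha ih =>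
    intro u hu
    obtain ⟨Φ, hΦm, ⟨C, hΦC⟩, hΦc, hΦ⟩ := ih a fun t ht => (ha t ht).le
    obtain ⟨C', hC'⟩ := hb a
    have hua : u ≤ a := hu a (Finset.mem_insert_self _ _)
    set k : S × Obs p → ℝ := fun w => h a w * Φ w with hk
    have hkm : Measurable k := (hm a).mul hΦm
    have hkC : ∀ w, |k w| ≤ C' * C := fun w => by
      rw [hk, abs_mul]
      exact mul_le_mul (hC' w) (hΦC w) (abs_nonneg _) ((abs_nonneg _).trans (hC' w))
    refine ⟨fun w => ∫ w', k w' ∂(M.trans (a - u) w), measurable_integral_trans M _ hkm,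
      ⟨C' * C, fun w => abs_integral_le_of_bdd hkC⟩, fun hc =>
        hT _ _ ((hc a).mul (hΦc hc)) hkm ⟨_, hkC⟩, fun z s => ?_⟩
    have haF : a ∉ F := fun h => lt_irrefl _ (ha a h)
    choose D hD using hb
    have hint : Integrable (fun ω => ∏ t ∈ F, h t (XY (s + t) ω)) (M.law z) := by
      refine .of_bound (Finset.measurable_prod F fun t _ =>
        (hm t).comp (measurable_XY _)).aestronglyMeasurable (∏ t ∈ F, D t)
        (Eventually.of_forall fun ω => ?_)
      rw [Real.norm_eq_abs, Finset.abs_prod]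
      exact Finset.prod_le_prod (fun t _ => abs_nonneg _) fun t _ => hD t _
    have hham : Measurable[fullFiltration S p (s + a)] fun ω => h a (XY (s + a) ω) :=
      (hm a).comp (measurable_XY_fullFiltration le_rfl)
    have h1 : (M.law z)[fun ω => ∏ t ∈ insert a F, h t (XY (s + t) ω) | fullFiltration S p (s + a)]
        =ᵐ[M.law z] fun ω => k (XY (s + a) ω) := by
      have e0 : (fun ω => ∏ t ∈ insert a F, h t (XY (s + t) ω)) =
          fun ω : PathSpace S p => h a (XY (s + a) ω) * ∏ t ∈ F, h t (XY (s + t) ω) :=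
        funext fun ω => Finset.prod_insert haF
      rw [e0]
      refine (condExp_stronglyMeasurable_mul_of_bound ((fullFiltration S p).le _)
        hham.stronglyMeasurable hint C' (Eventually.of_forall fun ω => hC' _)).trans ?_
      filter_upwards [hΦ z s] with ω hω
      rw [Pi.mul_apply, hω]
    refine (condExp_condExp_of_le ((fullFiltration S p).mono (add_le_add_right hua s))
      ((fullFiltration S p).le _)).symm.trans ((condExp_congr_ae h1).trans ?_)
    have e : s + a = s + u + (a - u) := by rw [add_assoc, add_tsub_cancel_of_le hua]
    rw [e]
    exact condExp_XY_add M z (s + u) (a - u) hkm hkC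

end Markov
end FilterStability

/-! ### From C₀ to bounded continuous functions for the Feller kernels. -/

namespace FilterStability

section Cutoff

variable {p : ℕ}

/-- Cutoff functions on `ℝ^p` which vanish at infinity and increase to `1`. -/
noncomputable def cutoff (n : ℕ) (y : Obs p) : ℝ := (1 + ‖y‖ / (n + 1))⁻¹

theorem continuous_cutoff (n : ℕ) : Continuous (cutoff (p := p) n) :=
  Continuous.inv₀ (by fun_prop) fun y => by positivity

theorem cutoff_nonneg (n : ℕ) (y : Obs p) : 0 ≤ cutoff n y := by
  unfold cutoff; positivity

theorem cutoff_le_one (n : ℕ) (y : Obs p) : cutoff n y ≤ 1 :=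
  inv_le_one_of_one_le₀ (by simp only [le_add_iff_nonneg_right]; positivity)

theorem cutoff_zero_right (n : ℕ) : cutoff n (0 : Obs p) = 1 := by simp [cutoff]

theorem tendsto_cutoff (y : Obs p) : Tendsto (fun n => cutoff n y) atTop (𝓝 1) := by
  have h : Tendsto (fun n : ℕ => ‖y‖ / ((n : ℝ) + 1)) atTop (𝓝 0) :=
    tendsto_const_nhds.div_atTop (tendsto_atTop_add_const_right _ _ tendsto_natCast_atTop_atTop)
  have := (h.const_add 1).inv₀ (by norm_num)
  simpa [cutoff] using this

theorem tendsto_cutoff_cocompact (n : ℕ) :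
    Tendsto (cutoff (p := p) n) (cocompact (Obs p)) (𝓝 0) := by
  refine tendsto_inv_atTop_zero.comp (tendsto_atTop_add_const_left _ _ ?_)
  exact (tendsto_norm_cocompact_atTop (E := Obs p)).atTop_div_const (by positivity)

end Cutoff

section Feller

variable {S : Type*} [TopologicalSpace S] {p : ℕ}

/-- A bounded continuous function on `S × ℝ^p` multiplied by a cutoff function. -/
noncomputable def mulCutoff [CompactSpace S] {k : S × Obs p → ℝ} (hk : Continuous k) {C : ℝ}
    (hC : ∀ w, |k w| ≤ C) (n : ℕ) :
    C₀(S × Obs p, ℝ) where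
  toFun w := k w * cutoff n w.2
  continuous_toFun := hk.mul ((continuous_cutoff n).comp continuous_snd)
  zero_at_infty' := by
    have h1 : Tendsto (Prod.snd : S × Obs p → Obs p) (cocompact _) (cocompact _) :=
      (isProperMap_iff_tendsto_cocompact.1 isProperMap_snd_of_compactSpace).2
    have h2 := ((tendsto_cutoff_cocompact n).comp h1).const_mul C
    rw [mul_zero] at h2
    refine squeeze_zero_norm (fun w => ?_) h2
    rw [Real.norm_eq_abs, abs_mul, abs_of_nonneg (cutoff_nonneg _ _)]
    exact mul_le_mul_of_nonneg_right (hC w) (cutoff_nonneg _ _)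

variable [MeasurableSpace S] (M : FilteringModel S p)

theorem continuous_integral_mulCutoff [CompactSpace S] (t : ℝ≥0) {k : S × Obs p → ℝ}
    (hk : Continuous k) {C : ℝ}
    (hC : ∀ w, |k w| ≤ C) (n : ℕ) :
    Continuous fun w => ∫ w', k w' * cutoff n w'.2 ∂(M.trans t w) := by
  obtain ⟨g, hg⟩ := M.feller.map_zeroAtInfty t (mulCutoff hk hC n)
  have : (fun w => ∫ w', k w' * cutoff n w'.2 ∂(M.trans t w)) = g := funext fun w => (hg w).symm
  rw [this]
  exact map_continuous g

theorem continuous_integral_cutoff [CompactSpace S] (t : ℝ≥0) (n : ℕ) :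
    Continuous fun w => ∫ w', cutoff n w'.2 ∂(M.trans t w) := by
  simpa using continuous_integral_mulCutoff M t (k := fun _ => (1 : ℝ)) continuous_const
    (C := 1) (by simp) n

/-- Pointwise |k - kχ| ≤ C(1 - χ). The resulting bound does not involve k except through C, and
depends continuously on the starting point when `S` is compact. -/
theorem abs_integral_sub_integral_mul_cutoff_le (t : ℝ≥0) {k : S × Obs p → ℝ} (hk : Measurable k)
    {C : ℝ} (hC : ∀ w, |k w| ≤ C) (n : ℕ) (w : S × Obs p) :
    |∫ w', k w' ∂(M.trans t w) - ∫ w', k w' * cutoff n w'.2 ∂(M.trans t w)| ≤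
      C * (1 - ∫ w', cutoff n w'.2 ∂(M.trans t w)) := by
  have hcm : Measurable fun w' : S × Obs p => cutoff n w'.2 :=
    (continuous_cutoff n).measurable.comp measurable_snd
  have hχ : Integrable (fun w' : S × Obs p => cutoff n w'.2) (M.trans t w) :=
    .of_bound hcm.aestronglyMeasurable 1 (Eventually.of_forall fun w' => by
      rw [Real.norm_eq_abs, abs_of_nonneg (cutoff_nonneg _ _)]; exact cutoff_le_one _ _)
  have hki : Integrable k (M.trans t w) :=
    .of_bound hk.aestronglyMeasurable C (Eventually.of_forall hC)
  have h1 : ∫ w', (1 - cutoff n w'.2) ∂(M.trans t w) = 1 - ∫ w', cutoff n w'.2 ∂(M.trans t w) := by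
    rw [integral_sub (integrable_const _) hχ]; simp
  rw [← h1, ← integral_const_mul, ← integral_sub hki
    (hχ.bdd_mul (c := C) hk.aestronglyMeasurable (Eventually.of_forall hC))]
  rw [← Real.norm_eq_abs]
  refine norm_integral_le_of_norm_le (((integrable_const _).sub hχ).const_mul C)
    (Eventually.of_forall fun w' => ?_)
  have e : k w' - k w' * cutoff n w'.2 = k w' * (1 - cutoff n w'.2) := by ring
  have h0 : 0 ≤ 1 - cutoff n w'.2 := sub_nonneg.2 (cutoff_le_one _ _)
  rw [e, Real.norm_eq_abs, abs_mul, abs_of_nonneg h0]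
  exact mul_le_mul_of_nonneg_right (hC w') h0

theorem tendsto_integral_cutoff (t : ℝ≥0) (w : S × Obs p) :
    Tendsto (fun n => ∫ w', cutoff n w'.2 ∂(M.trans t w)) atTop (𝓝 1) := by
  have h := tendsto_integral_of_dominated_convergence (μ := M.trans t w)
    (F := fun n w' => cutoff n w'.2) (f := fun _ => 1) (fun _ => 1)
    (fun n => ((continuous_cutoff n).measurable.comp measurable_snd).aestronglyMeasurable)
    (integrable_const _) (fun n => Eventually.of_forall fun w' => by
      rw [Real.norm_eq_abs, abs_of_nonneg (cutoff_nonneg _ _)]; exact cutoff_le_one _ _)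
    (Eventually.of_forall fun w' => tendsto_cutoff w'.2)
  simpa using h

/-- The Feller transition kernels preserve bounded continuous functions. -/
theorem continuous_integral_trans [CompactSpace S] (t : ℝ≥0) (k : S × Obs p → ℝ) (hk : Continuous k)
    (hkm : Measurable k) (hb : ∃ C, ∀ w, |k w| ≤ C) :
    Continuous fun w => ∫ w', k w' ∂(M.trans t w) := by
  obtain ⟨C, hC⟩ := hb
  refine continuous_iff_continuousAt.2 fun w₀ =>
    continuousAt_of_locally_uniform_approx_of_continuousAt fun u hu => ?_
  obtain ⟨ε, hε, hεu⟩ := Metric.mem_uniformity_dist.1 hu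
  -- Conservativity makes the error small at `w₀` for large n; continuity of the error bound keeps
  -- it small nearby, giving locally uniform approximation by continuous functions.
  have hlim : Tendsto (fun n => C * (1 - ∫ w', cutoff n w'.2 ∂(M.trans t w₀))) atTop (𝓝 0) := by
    simpa using ((tendsto_integral_cutoff M t w₀).const_sub 1).const_mul C
  obtain ⟨n, hn⟩ := (hlim.eventually (gt_mem_nhds hε)).exists
  have hcont : Continuous fun w => C * (1 - ∫ w', cutoff n w'.2 ∂(M.trans t w)) :=
    continuous_const.mul (continuous_const.sub (continuous_integral_cutoff M t n))
  refine ⟨_, hcont.continuousAt.eventually (gt_mem_nhds hn), _,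
    (continuous_integral_mulCutoff M t hk hC n).continuousAt, fun w hw => hεu ?_⟩
  exact (abs_integral_sub_integral_mul_cutoff_le M t hkm hC n w).trans_lt hw

end Feller
end FilterStability

/-! ### Markov property on path space and conditioning on observations. -/

namespace FilterStability
section PathMarkov

variable {S : Type*} [TopologicalSpace S] {p : ℕ}

theorem tendsto_add_one_div (t : ℝ≥0) :
    Tendsto (fun n : ℕ => t + 1 / ((n : ℝ≥0) + 1)) atTop (𝓝[>] t) := by
  refine tendsto_nhdsWithin_iff.2 ⟨?_, Eventually.of_forall fun n => ?_⟩
  · have : Tendsto (fun n : ℕ => 1 / ((n : ℝ≥0) + 1)) atTop (𝓝 0) :=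
      tendsto_one_div_add_atTop_nhds_zero_nat
    simpa using this.const_add t
  · simp only [Set.mem_Ioi, lt_add_iff_pos_right]; positivity

theorem tendsto_X_nhdsGT (t : ℝ≥0) (ω : PathSpace S p) :
    Tendsto (fun s => X s ω) (𝓝[>] t) (𝓝 (X t ω)) :=
  ((ω.1.2 t).1.mono Set.Ioi_subset_Ici_self)

theorem tendsto_Y_nhdsGT (t : ℝ≥0) (ω : PathSpace S p) :
    Tendsto (fun s => Y s ω) (𝓝[>] t) (𝓝 (Y t ω)) :=
  ((ω.2.2 t).1.mono Set.Ioi_subset_Ici_self)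

variable [MeasurableSpace S] (M : FilteringModel S p)

theorem rawObsFiltration_le_obsFiltration (t : ℝ≥0) :
    rawObsFiltration S p t ≤ M.obsFiltration t := fun A hA =>
  ⟨(rawObsFiltration S p).le t A hA, fun _ hs _ _ =>
    ⟨A, (rawObsFiltration S p).mono hs.le A hA, ae_eq_rfl⟩⟩

instance isProbabilityMeasure_lawOf (ρ : Measure (S × Obs p)) [IsProbabilityMeasure ρ] :
    IsProbabilityMeasure (M.lawOf ρ) := by
  unfold FilteringModel.lawOf; infer_instance

instance isProbabilityMeasure_signalLaw (μ : Measure S) [IsProbabilityMeasure μ] :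
    IsProbabilityMeasure (M.signalLaw μ) := by
  unfold FilteringModel.signalLaw; infer_instance

theorem integrable_prod_XY {h : ℝ≥0 → S × Obs p → ℝ} (hm : ∀ t, Measurable (h t))
    (hb : ∀ t, ∃ C, ∀ w, |h t w| ≤ C) (F : Finset ℝ≥0) (P : Measure (PathSpace S p))
    [IsFiniteMeasure P] : Integrable (fun ω => ∏ t ∈ F, h t (XY t ω)) P := by
  choose D hD using hb
  refine .of_bound (Finset.measurable_prod F fun t _ =>
    (hm t).comp (measurable_XY _)).aestronglyMeasurable (∏ t ∈ F, D t)
    (Eventually.of_forall fun ω => ?_)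
  rw [Real.norm_eq_abs, Finset.abs_prod]
  exact Finset.prod_le_prod (fun t _ => abs_nonneg _) fun t _ => hD t _

variable [CompactSpace S]

/-- The function Φ of the finite-dimensional Markov property is identified by evaluating it at s =
0, where `law w` starts almost surely from w. -/
theorem continuous_and_condExp_integral_prod_XY {h : ℝ≥0 → S × Obs p → ℝ}
    (hm : ∀ t, Measurable (h t)) (hb : ∀ t, ∃ C, ∀ w, |h t w| ≤ C) (F : Finset ℝ≥0) :
    ((∀ t, Continuous (h t)) → Continuous fun w => ∫ ω, ∏ t ∈ F, h t (XY t ω) ∂(M.law w)) ∧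
    ∀ z s, (M.law z)[fun ω => ∏ t ∈ F, h t (XY (s + t) ω) | fullFiltration S p s]
      =ᵐ[M.law z] fun ω => ∫ ω', ∏ t ∈ F, h t (XY t ω') ∂(M.law (XY s ω)) := by
  obtain ⟨Φ, hΦm, -, hΦc, hΦ⟩ := exists_condExp_prod_XY M (continuous_integral_trans M) hm hb F 0
    fun t _ => zero_le
  have key : ∀ w, ∫ ω, ∏ t ∈ F, h t (XY t ω) ∂(M.law w) = Φ w := by
    intro w
    have h1 := hΦ w 0
    simp only [zero_add] at h1
    rw [← integral_condExp ((fullFiltration S p).le 0), integral_congr_ae h1,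
      ← integral_map (f := Φ) (measurable_XY 0).aemeasurable hΦm.aestronglyMeasurable,
      M.initial, integral_dirac' _ _ hΦm.stronglyMeasurable]
  simp only [key]
  refine ⟨hΦc, fun z s => ?_⟩
  simpa only [add_zero] using hΦ z s

/-- The Markov property on path space, under `P_z`. -/
theorem map_restrict_pathShift (z : S × Obs p) (s : ℝ≥0) {B : Set (PathSpace S p)}
    (hB : MeasurableSet[fullFiltration S p s] B) :
    ((M.law z).restrict B).map (pathShift s) =
      (((M.law z).restrict B).map (XY s)).bind M.law := by
  have : IsFiniteMeasure ((((M.law z).restrict B).map (XY s)).bind M.law) := by infer_instance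
  refine measure_pathSpace_ext fun F A hA => ?_
  set h : ℝ≥0 → S × Obs p → ℝ := fun t => (A t).indicator 1 with hh
  have hm : ∀ t, Measurable (h t) := fun t => measurable_one.indicator (hA t)
  have hb : ∀ t, ∃ C, ∀ w, |h t w| ≤ C := fun t => ⟨1, fun w => by
    simp only [hh, Set.indicator, Pi.one_apply]; split_ifs <;> simp⟩
  have hCm : MeasurableSet (⋂ t ∈ F, XY (S := S) (p := p) t ⁻¹' A t) :=
    F.measurableSet_biInter fun t _ => measurable_XY t (hA t)
  have hind : ∀ ω, ∏ t ∈ F, h t (XY t ω) =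
      (⋂ t ∈ F, XY (S := S) (p := p) t ⁻¹' A t).indicator (fun _ => (1 : ℝ)) ω := by
    intro ω
    by_cases hω : ω ∈ ⋂ t ∈ F, XY (S := S) (p := p) t ⁻¹' A t
    · rw [Set.indicator_of_mem hω]
      refine Finset.prod_eq_one fun t ht => ?_
      exact Set.indicator_of_mem (s := A t) (a := XY t ω) (Set.mem_iInter₂.1 hω t ht) 1
    · rw [Set.indicator_of_notMem hω]
      simp only [Set.mem_iInter, not_forall] at hω
      obtain ⟨t, ht, hωt⟩ := hω
      exact Finset.prod_eq_zero ht (Set.indicator_of_notMem (s := A t) (a := XY t ω) hωt 1)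
  have hreal : ∀ P : Measure (PathSpace S p), IsFiniteMeasure P →
      P.real (⋂ t ∈ F, XY (S := S) (p := p) t ⁻¹' A t) = ∫ ω, ∏ t ∈ F, h t (XY t ω) ∂P := by
    intro P _
    simp_rw [hind]
    rw [integral_indicator_const _ hCm, smul_eq_mul, mul_one]
  have hprodm : Measurable fun ω : PathSpace S p => ∏ t ∈ F, h t (XY t ω) :=
    Finset.measurable_prod F fun t _ => (hm t).comp (measurable_XY _)
  rw [← measureReal_eq_measureReal_iff, hreal _ inferInstance, hreal _ inferInstance,
    integral_bind_kernel (integrable_prod_XY hm hb F _),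
    integral_map (measurable_pathShift s).aemeasurable hprodm.aestronglyMeasurable,
    integral_map (measurable_XY s).aemeasurable
      (hprodm.stronglyMeasurable.integral_kernel (κ := M.law)).aestronglyMeasurable]
  simp_rw [XY_pathShift]
  have hint : Integrable (fun ω => ∏ t ∈ F, h t (XY (s + t) ω)) (M.law z) := by
    have := integrable_prod_XY hm hb F ((M.law z).map (pathShift s))
    exact this.comp_measurable (measurable_pathShift s)
  rw [← setIntegral_condExp ((fullFiltration S p).le s) hint hB]
  exact integral_congr_ae (ae_restrict_of_ae
    ((continuous_and_condExp_integral_prod_XY M hm hb F).2 z s))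

/-- The Markov property on path space, under `P_ρ`. -/
theorem map_restrict_pathShift_lawOf (ρ : Measure (S × Obs p)) (s : ℝ≥0) {B : Set (PathSpace S p)}
    (hB : MeasurableSet[fullFiltration S p s] B) :
    ((M.lawOf ρ).restrict B).map (pathShift s) =
      (((M.lawOf ρ).restrict B).map (XY s)).bind M.law := by
  have hB' := (fullFiltration S p).le s B hB
  ext C hC
  have hm : MeasurableSet (pathShift s ⁻¹' C) := measurable_pathShift s hC
  have hCm : Measurable fun ω : PathSpace S p => M.law (XY s ω) C :=
    (Kernel.measurable_coe _ hC).comp (measurable_XY s)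
  have key : ∀ z, M.law z (pathShift s ⁻¹' C ∩ B) = ∫⁻ ω in B, M.law (XY s ω) C ∂(M.law z) := by
    intro z
    have e := congrArg (fun P => P C) (map_restrict_pathShift M z s hB)
    rwa [Measure.map_apply (measurable_pathShift s) hC, Measure.restrict_apply hm,
      Measure.bind_apply hC (Kernel.aemeasurable _),
      lintegral_map (Kernel.measurable_coe _ hC) (measurable_XY _)] at e
  rw [Measure.map_apply (measurable_pathShift s) hC, Measure.restrict_apply hm,
    Measure.bind_apply hC (Kernel.aemeasurable _),
    lintegral_map (Kernel.measurable_coe _ hC) (measurable_XY _), FilteringModel.lawOf,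
    Measure.bind_apply (hm.inter hB') (Kernel.aemeasurable _), ← lintegral_indicator hB',
    Measure.lintegral_bind (Kernel.aemeasurable _) (hCm.indicator hB').aemeasurable]
  refine lintegral_congr fun z => ?_
  rw [key, lintegral_indicator hB']

theorem setIntegral_pathShift (μ : Measure S) [IsProbabilityMeasure μ] (s : ℝ≥0)
    {ψ : PathSpace S p → ℝ} (hψ : Measurable ψ) {C : ℝ} (hC : ∀ ω, |ψ ω| ≤ C) {k : S → ℝ}
    (hk : Measurable k) (hψk : ∀ x y, ∫ ω, ψ ω ∂(M.law (x, y)) = k x) {B : Set (PathSpace S p)}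
    (hB : MeasurableSet[fullFiltration S p s] B) :
    ∫ ω in B, ψ (pathShift s ω) ∂(M.signalLaw μ) = ∫ ω in B, k (X s ω) ∂(M.signalLaw μ) := by
  have e := congrArg (fun P => ∫ ω, ψ ω ∂P)
    (map_restrict_pathShift_lawOf M (μ.prod (Measure.dirac 0)) s hB)
  have hfin : IsFiniteMeasure ((((M.lawOf (μ.prod (Measure.dirac 0))).restrict B).map
    (XY s)).bind M.law) := by infer_instance
  have hψk' : ∀ w, ∫ ω, ψ ω ∂(M.law w) = k w.1 := fun w => hψk w.1 w.2
  rw [integral_map (measurable_pathShift s).aemeasurable hψ.aestronglyMeasurable,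
    integral_bind_kernel (.of_bound hψ.aestronglyMeasurable C (Eventually.of_forall hC))] at e
  simp_rw [hψk'] at e
  exact e.trans (integral_map (f := fun w : S × Obs p => k w.1) (measurable_XY s).aemeasurable
    (hk.comp measurable_fst).aestronglyMeasurable)

variable [BorelSpace S]

/-- For `A` in the augmented observation filtration, integrals over `A` of a right-continuous
functional of the future can be computed by conditioning on the present signal. -/
theorem setIntegral_pathShift_obs (μ : Measure S) [IsProbabilityMeasure μ] (t : ℝ≥0)
    {ψ : PathSpace S p → ℝ} (hψ : Measurable ψ) {C : ℝ} (hC : ∀ ω, |ψ ω| ≤ C) {k : S → ℝ}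
    (hk : Continuous k) (hψk : ∀ x y, ∫ ω, ψ ω ∂(M.law (x, y)) = k x)
    (hψc : ∀ ω, Tendsto (fun s => ψ (pathShift s ω)) (𝓝[>] t) (𝓝 (ψ (pathShift t ω))))
    {A : Set (PathSpace S p)} (hA : MeasurableSet[M.obsFiltration t] A) :
    ∫ ω in A, ψ (pathShift t ω) ∂(M.signalLaw μ) = ∫ ω in A, k (X t ω) ∂(M.signalLaw μ) := by
  have hkC : ∀ x, |k x| ≤ C := fun x => by
    rw [← hψk x 0]; exact abs_integral_le_of_bdd hC
  -- An event of the augmented σ-algebra at t is known to be a.e. equal to a raw observation event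
  -- only at times later than t. The Markov property is therefore used at s n ↓ t, and
  -- right-continuity with dominated convergence brings the identity back to t.
  set s : ℕ → ℝ≥0 := fun n => t + 1 / ((n : ℝ≥0) + 1) with hs
  have hst : Tendsto s atTop (𝓝[>] t) := tendsto_add_one_div t
  have heq : ∀ n, ∫ ω in A, ψ (pathShift (s n) ω) ∂(M.signalLaw μ) =
      ∫ ω in A, k (X (s n) ω) ∂(M.signalLaw μ) := by
    intro n
    have hlt : t < s n := by simp only [hs, lt_add_iff_pos_right]; positivity
    obtain ⟨B, hB, hAB⟩ := hA.2 (s n) hlt (μ.prod (Measure.dirac 0)) inferInstance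
    have e := setIntegral_pathShift M μ (s n) hψ hC hk.measurable hψk
      (rawObsFiltration_le_fullFiltration _ B hB)
    exact (setIntegral_congr_set hAB).trans (e.trans (setIntegral_congr_set hAB).symm)
  have l1 : Tendsto (fun n => ∫ ω in A, ψ (pathShift (s n) ω) ∂(M.signalLaw μ)) atTop
      (𝓝 (∫ ω in A, ψ (pathShift t ω) ∂(M.signalLaw μ))) :=
    tendsto_integral_of_dominated_convergence (fun _ => C)
      (fun n => (hψ.comp (measurable_pathShift _)).aestronglyMeasurable) (integrable_const _)
      (fun n => Eventually.of_forall fun ω => hC _)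
      (Eventually.of_forall fun ω => (hψc ω).comp hst)
  have l2 : Tendsto (fun n => ∫ ω in A, k (X (s n) ω) ∂(M.signalLaw μ)) atTop
      (𝓝 (∫ ω in A, k (X t ω) ∂(M.signalLaw μ))) :=
    tendsto_integral_of_dominated_convergence (fun _ => C)
      (fun n => (hk.measurable.comp (measurable_X _)).aestronglyMeasurable) (integrable_const _)
      (fun n => Eventually.of_forall fun ω => hkC _)
      (Eventually.of_forall fun ω =>
        (hk.continuousAt.tendsto.comp (tendsto_X_nhdsGT t ω)).comp hst)
  exact tendsto_nhds_unique (l1.congr heq) l2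

/-- The bridge between filtering and prediction: given the observations, predicting ψ of the future
is the same as estimating its expectation k at the present signal. -/
theorem condExp_pathShift_obs (μ : Measure S) [IsProbabilityMeasure μ] (t : ℝ≥0)
    {ψ : PathSpace S p → ℝ} (hψ : Measurable ψ) {C : ℝ} (hC : ∀ ω, |ψ ω| ≤ C) {k : S → ℝ}
    (hk : Continuous k) (hψk : ∀ x y, ∫ ω, ψ ω ∂(M.law (x, y)) = k x)
    (hψc : ∀ ω, Tendsto (fun s => ψ (pathShift s ω)) (𝓝[>] t) (𝓝 (ψ (pathShift t ω)))) :
    (M.signalLaw μ)[fun ω => ψ (pathShift t ω) | M.obsFiltration t] =ᵐ[M.signalLaw μ]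
      (M.signalLaw μ)[fun ω => k (X t ω) | M.obsFiltration t] := by
  have hkC : ∀ x, |k x| ≤ C := fun x => by
    rw [← hψk x 0]; exact abs_integral_le_of_bdd hC
  have i1 : Integrable (fun ω => ψ (pathShift t ω)) (M.signalLaw μ) :=
    .of_bound (hψ.comp (measurable_pathShift _)).aestronglyMeasurable C
      (Eventually.of_forall fun ω => hC _)
  have i2 : Integrable (fun ω => k (X t ω)) (M.signalLaw μ) :=
    .of_bound (hk.measurable.comp (measurable_X _)).aestronglyMeasurable C
      (Eventually.of_forall fun ω => hkC _)
  refine ae_eq_condExp_of_forall_setIntegral_eq (M.obsFiltration.le t) i2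
    (fun A _ _ => integrable_condExp.integrableOn) (fun A hA _ => ?_)
    stronglyMeasurable_condExp.aestronglyMeasurable
  rw [setIntegral_condExp (M.obsFiltration.le t) i1 hA]
  exact setIntegral_pathShift_obs M μ t hψ hC hk hψk hψc hA

end PathMarkov
end FilterStability

/-! ### Functionals of the observation increments, and observability as density. -/

namespace FilterStability
section Functionals

variable {S : Type*} [TopologicalSpace S] {p : ℕ}

/-- The product of bounded continuous functions of the observation increments `Y_t - Y_0`, over a
finite set of times. -/
noncomputable def obsProd (φ : ℝ≥0 → Obs p →ᵇ ℝ) (F : Finset ℝ≥0) (ω : PathSpace S p) : ℝ :=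
  ∏ t ∈ F, φ t (Y t ω - Y 0 ω)

theorem abs_obsProd_le (φ : ℝ≥0 → Obs p →ᵇ ℝ) (F : Finset ℝ≥0) (ω : PathSpace S p) :
    |obsProd φ F ω| ≤ ∏ t ∈ F, ‖φ t‖ := by
  rw [obsProd, Finset.abs_prod]
  exact Finset.prod_le_prod (fun t _ => abs_nonneg _) fun t _ => (φ t).norm_coe_le_norm _

theorem tendsto_obsProd_pathShift (φ : ℝ≥0 → Obs p →ᵇ ℝ) (F : Finset ℝ≥0) (t : ℝ≥0)
    (ω : PathSpace S p) : Tendsto (fun s => obsProd φ F (pathShift s ω)) (𝓝[>] t)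
      (𝓝 (obsProd φ F (pathShift t ω))) := by
  have hadd : ∀ r, Tendsto (fun s => Y (s + r) ω) (𝓝[>] t) (𝓝 (Y (t + r) ω)) := fun r =>
    (tendsto_Y_nhdsGT (t + r) ω).comp (tendsto_nhdsWithin_iff.2
      ⟨(by fun_prop : Continuous fun s : ℝ≥0 => s + r).continuousAt.tendsto.mono_left
        nhdsWithin_le_nhds, by
        filter_upwards [self_mem_nhdsWithin] with s hs
        simpa using hs⟩)
  refine tendsto_finsetProd F fun r _ => ?_
  exact ((φ r).continuous.continuousAt.tendsto).comp ((hadd r).sub (hadd 0))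

variable [MeasurableSpace S] (M : FilteringModel S p)

theorem measurable_obsProd (φ : ℝ≥0 → Obs p →ᵇ ℝ) (F : Finset ℝ≥0) :
    Measurable (obsProd (S := S) φ F) :=
  Finset.measurable_fun_prod F fun t _ =>
    (φ t).continuous.measurable.comp ((measurable_Y t).sub (measurable_Y 0))

theorem measurable_obsProd_sup (φ : ℝ≥0 → Obs p →ᵇ ℝ) (F : Finset ℝ≥0) :
    Measurable[signalSigma S p ⊔ obsIncrementSigma S p] (obsProd (S := S) φ F) := by
  refine Finset.measurable_fun_prod F fun t _ => (φ t).continuous.measurable.comp ?_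
  refine Measurable.mono ?_ (le_sup_right (a := signalSigma S p)) le_rfl
  exact measurable_iff_comap_le.2 (le_iSup (fun t => MeasurableSpace.comap
    (fun ω : PathSpace S p => Y t ω - Y 0 ω) inferInstance) t)

theorem measurable_obsProd_pathShift (φ : ℝ≥0 → Obs p →ᵇ ℝ) (F : Finset ℝ≥0) (s : ℝ≥0) :
    Measurable[⨆ t, M.obsFiltration t] fun ω => obsProd φ F (pathShift s ω) := by
  have hY : ∀ t, Measurable[⨆ t, M.obsFiltration t] (Y (S := S) (p := p) t) := fun t =>
    (measurable_Y_rawObsFiltration le_rfl).mono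
      ((rawObsFiltration_le_obsFiltration M t).trans (le_iSup (fun t => M.obsFiltration t) t)) le_rfl
  refine Finset.measurable_fun_prod F fun t _ => (φ t).continuous.measurable.comp ?_
  exact (hY (s + t)).sub (hY (s + 0))

theorem measurable_comp_X_sup {f : S → ℝ} (hf : Measurable f) (t : ℝ≥0) :
    Measurable[signalSigma S p ⊔ obsIncrementSigma S p] fun ω : PathSpace S p => f (X t ω) := by
  refine hf.comp (Measurable.mono ?_ (le_sup_left (b := obsIncrementSigma S p)) le_rfl)
  exact measurable_iff_comap_le.2 (le_iSup (fun t => MeasurableSpace.comap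
    (X (S := S) (p := p) t) inferInstance) t)

variable [PolishSpace S] [BorelSpace S]

theorem ae_XY_zero (z : S × Obs p) : ∀ᵐ ω ∂(M.law z), XY 0 ω = z := by
  have h : ∀ᵐ w ∂((M.law z).map (XY 0)), w = z := by
    rw [M.initial]; exact (ae_dirac_iff (measurableSet_singleton z)).2 rfl
  exact ae_of_ae_map (measurable_XY 0).aemeasurable h

variable [CompactSpace S]

/-- Started from (x, 0), increments coincide with the observations themselves, so Feller continuity
for products of coordinate functions applies. -/
theorem continuous_integral_obsProd (φ : ℝ≥0 → Obs p →ᵇ ℝ) (F : Finset ℝ≥0) :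
    Continuous fun x : S => ∫ ω, obsProd φ F ω ∂(M.law (x, 0)) := by
  have hc : ∀ t, Continuous fun w : S × Obs p => φ t w.2 := fun t => by fun_prop
  have h := (continuous_and_condExp_integral_prod_XY M (h := fun t w => φ t w.2)
    (fun t => (hc t).measurable) (fun t => ⟨‖φ t‖, fun w => (φ t).norm_coe_le_norm _⟩) F).1 hc
  refine (h.comp (by fun_prop : Continuous fun x : S => (x, (0 : Obs p)))).congr fun x => ?_
  refine integral_congr_ae ?_
  filter_upwards [ae_XY_zero M (x, 0)] with ω hω
  have h0 : Y 0 ω = 0 := congrArg Prod.snd hω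
  simp only [obsProd, h0, sub_zero]
  rfl

/-- The expectation of `obsProd φ F` as a continuous function of the initial signal state. -/
noncomputable def obsProdExpectation (φ : ℝ≥0 → Obs p →ᵇ ℝ) (F : Finset ℝ≥0) : C(S, ℝ) :=
  ⟨fun x => ∫ ω, obsProd φ F ω ∂(M.law (x, 0)), continuous_integral_obsProd M φ F⟩

theorem integral_obsProd (φ : ℝ≥0 → Obs p →ᵇ ℝ) (F : Finset ℝ≥0) (x : S) (y : Obs p) :
    ∫ ω, obsProd φ F ω ∂(M.law (x, y)) = obsProdExpectation M φ F x :=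
  M.cond_indep_increments _ (measurable_obsProd_sup φ F) ⟨_, abs_obsProd_le φ F⟩ x y 0

theorem condExp_obsProd_pathShift (μ : Measure S) [IsProbabilityMeasure μ]
    (φ : ℝ≥0 → Obs p →ᵇ ℝ) (F : Finset ℝ≥0) (t : ℝ≥0) :
    (M.signalLaw μ)[fun ω => obsProd φ F (pathShift t ω) | M.obsFiltration t] =ᵐ[M.signalLaw μ]
      (M.signalLaw μ)[fun ω => obsProdExpectation M φ F (X t ω) | M.obsFiltration t] :=
  condExp_pathShift_obs M μ t (measurable_obsProd φ F) (abs_obsProd_le φ F)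
    (obsProdExpectation M φ F).continuous (integral_obsProd M φ F)
    (tendsto_obsProd_pathShift φ F t)

theorem integral_signalLaw (μ : Measure S) [IsProbabilityMeasure μ] {ψ : PathSpace S p → ℝ}
    (hψ : Measurable ψ) {C : ℝ} (hC : ∀ ω, |ψ ω| ≤ C) :
    ∫ ω, ψ ω ∂(M.signalLaw μ) = ∫ x, ∫ ω, ψ ω ∂(M.law (x, 0)) ∂μ := by
  have hi : Integrable ψ (M.signalLaw μ) :=
    .of_bound hψ.aestronglyMeasurable C (Eventually.of_forall hC)
  have hm := hψ.stronglyMeasurable.integral_kernel (κ := M.law)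
  rw [FilteringModel.signalLaw, FilteringModel.lawOf, integral_bind_kernel hi,
    Measure.prod_dirac, integral_map (by fun_prop) hm.aestronglyMeasurable]

theorem ae_Y_zero (μ : Measure S) [IsProbabilityMeasure μ] :
    ∀ᵐ ω ∂(M.signalLaw μ), Y 0 ω = 0 := by
  have hm : MeasurableSet {ω : PathSpace S p | ¬ Y 0 ω = 0} :=
    (measurable_Y 0 (measurableSet_singleton 0)).compl
  rw [ae_iff, FilteringModel.signalLaw, FilteringModel.lawOf,
    Measure.bind_apply hm (Kernel.aemeasurable _), Measure.prod_dirac,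
    lintegral_map (Kernel.measurable_coe _ hm) (by fun_prop)]
  refine (lintegral_congr fun x => ?_).trans lintegral_zero
  rw [← ae_iff]
  filter_upwards [ae_XY_zero M (x, 0)] with ω hω using congrArg Prod.snd hω

/-- The law of the observations is determined by the expectations of `obsProd`. -/
theorem signalLaw_eq_on_obsSigma {μ ν : Measure S} [IsProbabilityMeasure μ]
    [IsProbabilityMeasure ν]
    (h : ∀ φ F, ∫ x, obsProdExpectation M φ F x ∂μ = ∫ x, obsProdExpectation M φ F x ∂ν)
    {A : Set (PathSpace S p)} (hA : MeasurableSet[obsSigma S p] A) :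
    M.signalLaw μ A = M.signalLaw ν A := by
  have key : ∀ (φ : ℝ≥0 → Obs p →ᵇ ℝ) (F : Finset ℝ≥0),
      ∫ ω, ∏ t ∈ F, φ t (Y t ω) ∂(M.signalLaw μ) = ∫ ω, ∏ t ∈ F, φ t (Y t ω) ∂(M.signalLaw ν) := by
    intro φ F
    have e : ∀ κ : Measure S, IsProbabilityMeasure κ →
        ∫ ω, ∏ t ∈ F, φ t (Y t ω) ∂(M.signalLaw κ) = ∫ x, obsProdExpectation M φ F x ∂κ := by
      intro κ _
      refine Eq.trans (integral_congr_ae ?_)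
        (integral_signalLaw M κ (measurable_obsProd φ F) (abs_obsProd_le φ F))
      filter_upwards [ae_Y_zero M κ] with ω hω
      simp only [obsProd, hω, sub_zero]
    rw [e μ inferInstance, e ν inferInstance, h]
  refine measure_eq_of_cylinders measurable_Y (fun F B hB => ?_) hA
  -- The `Unit` factor is a dummy that fits the two-factor extensionality theorem for products of
  -- bounded continuous functions.
  let G : PathSpace S p → (F → Obs p) × Unit := fun ω => (fun t => Y t.1 ω, ())
  have hG : Measurable G := Measurable.prodMk (measurable_pi_lambda _ fun t => measurable_Y t.1)
    measurable_const
  have hmap : (M.signalLaw μ).map G = (M.signalLaw ν).map G := by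
    refine Measure.ext_of_integral_prod_mul_boundedContinuousFunction fun f g => ?_
    have hc : Continuous fun q : (F → Obs p) × Unit => (∏ i, f i (q.1 i)) * g q.2 := by fun_prop
    rw [integral_map hG.aemeasurable hc.aestronglyMeasurable,
      integral_map hG.aemeasurable hc.aestronglyMeasurable]
    simp only [G]
    rw [integral_mul_const, integral_mul_const]
    congr 1
    let φ : ℝ≥0 → Obs p →ᵇ ℝ := fun t => if ht : t ∈ F then f ⟨t, ht⟩ else 0
    have e : ∀ ω : PathSpace S p, ∏ i, f i (Y i.1 ω) = ∏ t ∈ F, φ t (Y t ω) := by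
      intro ω
      rw [← Finset.prod_coe_sort F]
      refine Finset.prod_congr rfl fun i _ => ?_
      simp only [φ, i.2, dif_pos]
    simp_rw [e]
    exact key φ F
  let D : Set ((F → Obs p) × Unit) := ⋂ t : F, {q | q.1 t ∈ B t.1}
  have hD : MeasurableSet D := MeasurableSet.iInter fun t =>
    ((measurable_pi_apply t).comp measurable_fst) (hB t.1)
  have hpre : ⋂ t ∈ F, Y (S := S) t ⁻¹' B t = G ⁻¹' D := by
    ext ω
    simp [D, G]
  rw [hpre, ← Measure.map_apply hG hD, ← Measure.map_apply hG hD, hmap]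

/-- For an observable model the functions `obsProdExpectation` span a dense subspace of `C(S)`. -/
theorem dense_span_obsProdExpectation [Nonempty S] (hM : M.IsObservable) :
    Dense (Submodule.span ℝ {g : C(S, ℝ) | ∃ φ F, g = obsProdExpectation M φ F} : Set C(S, ℝ)) := by
  refine dense_of_separates_probabilityMeasures _ (Submodule.subset_span ?_) ?_
  -- The empty product supplies the constant 1; the choice of φ is immaterial.
  · refine ⟨fun _ => 0, ∅, ?_⟩
    ext x
    simp [obsProdExpectation, obsProd]
  · intro μ ν hμ hν h
    refine hM μ ν hμ hν fun A hA => signalLaw_eq_on_obsSigma M (fun φ F => ?_) hA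
    exact h _ (Submodule.subset_span ⟨φ, F, rfl⟩)

end Functionals
end FilterStability

/-! ### Stability of the filter. -/

namespace FilterStability
section Stability

variable {S : Type*} [TopologicalSpace S] [MeasurableSpace S] {p : ℕ} (M : FilteringModel S p)

/-- A version of the estimate `E^μ(g(X_t) | 𝓕^Y_t)`, for a fixed time. -/
noncomputable def signalEstimate (μ : Measure S) (g : C(S, ℝ)) (t : ℝ≥0) : PathSpace S p → ℝ :=
  (M.signalLaw μ)[fun ω => g (X t ω) | M.obsFiltration t]

theorem signalEstimate_smul (μ : Measure S) (c : ℝ) (g : C(S, ℝ)) (t : ℝ≥0) :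
    signalEstimate M μ (c • g) t =ᵐ[M.signalLaw μ] c • signalEstimate M μ g t :=
  condExp_smul c (fun ω => g (X t ω)) _

theorem signalLaw_absolutelyContinuous {μ ν : Measure S} [SFinite μ] [SFinite ν] (h : μ ≪ ν) :
    M.signalLaw μ ≪ M.signalLaw ν :=
  (h.prod Measure.AbsolutelyContinuous.rfl).comp_right M.law

variable [CompactSpace S]

theorem ae_abs_signalEstimate_le (μ : Measure S) (g : C(S, ℝ)) (t : ℝ≥0) :
    ∀ᵐ ω ∂(M.signalLaw μ), |signalEstimate M μ g t ω| ≤ ‖g‖ :=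
  ae_bdd_abs_condExp_of_ae_bdd_abs (Eventually.of_forall fun _ => g.norm_coe_le_norm _)

variable [BorelSpace S]

theorem integrable_comp_X (g : C(S, ℝ)) (t : ℝ≥0) (P : Measure (PathSpace S p))
    [IsFiniteMeasure P] : Integrable (fun ω => g (X t ω)) P :=
  .of_bound (g.continuous.measurable.comp (measurable_X t)).aestronglyMeasurable ‖g‖
    (Eventually.of_forall fun _ => g.norm_coe_le_norm _)

variable (μ : Measure S) [IsProbabilityMeasure μ]

theorem signalEstimate_add (g g' : C(S, ℝ)) (t : ℝ≥0) :
    signalEstimate M μ (g + g') t =ᵐ[M.signalLaw μ]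
      signalEstimate M μ g t + signalEstimate M μ g' t :=
  condExp_add (integrable_comp_X g t _) (integrable_comp_X g' t _) _

theorem ae_abs_signalEstimate_sub_le (g g' : C(S, ℝ)) (t : ℝ≥0) :
    ∀ᵐ ω ∂(M.signalLaw μ),
      |signalEstimate M μ g t ω - signalEstimate M μ g' t ω| ≤ ‖g - g'‖ := by
  filter_upwards [signalEstimate_add M μ (g - g') g' t,
    ae_abs_signalEstimate_le M μ (g - g') t] with ω h1 h2
  rw [sub_add_cancel] at h1
  rw [h1, Pi.add_apply, add_sub_cancel_right]
  exact h2

variable [PolishSpace S] (ν : Measure S) [IsProbabilityMeasure ν]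

/-- The estimates of `g(X_t)` under `P^μ` and `P^ν` merge along the dyadic times,
`P^μ`-almost surely. -/
def EstimatesMerge (g : C(S, ℝ)) : Prop :=
  ∀ᵐ ω ∂(M.signalLaw μ), Tendsto
    (fun t => signalEstimate M μ g t ω - signalEstimate M ν g t ω) (atTop ⊓ 𝓟 dyadics) (𝓝 0)

variable {μ ν}

theorem tendsto_congr_dyadics {x y : ℝ≥0 → ℝ} {l : ℝ} (h : ∀ t ∈ dyadics, x t = y t)
    (hx : Tendsto x (atTop ⊓ 𝓟 dyadics) (𝓝 l)) : Tendsto y (atTop ⊓ 𝓟 dyadics) (𝓝 l) :=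
  hx.congr' (eventually_inf_principal.2 (Eventually.of_forall h))

/-- Under both laws the estimate is a prediction of the same bounded functional of future
observations, so Blackwell–Dubins merging applies. Absolute continuity transfers the `P^ν`-null sets
to `P^μ`. -/
theorem estimatesMerge_obsProdExpectation (h : μ ≪ ν) (φ : ℝ≥0 → Obs p →ᵇ ℝ) (F : Finset ℝ≥0) :
    EstimatesMerge M μ ν (obsProdExpectation M φ F) := by
  have hac := signalLaw_absolutelyContinuous M h
  have h1 := ae_tendsto_condExp_sub_condExp hac M.obsFiltration
    (Z := fun t ω => obsProd φ F (pathShift t ω)) (measurable_obsProd_pathShift M φ F)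
    (C := ∏ t ∈ F, ‖φ t‖) fun t ω => abs_obsProd_le φ F _
  have h2 := (ae_ball_iff countable_dyadics).2 fun t _ => condExp_obsProd_pathShift M μ φ F t
  have h3 := (ae_ball_iff countable_dyadics).2 fun t _ =>
    hac.ae_le (condExp_obsProd_pathShift M ν φ F t)
  filter_upwards [h1, h2, h3] with ω a b c
  refine tendsto_congr_dyadics (fun t ht => ?_) a
  rw [b t ht, c t ht]
  rfl

theorem EstimatesMerge.of_mem_span (h : μ ≪ ν) {g : C(S, ℝ)}
    (hg : g ∈ Submodule.span ℝ {g : C(S, ℝ) | ∃ φ F, g = obsProdExpectation M φ F}) :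
    EstimatesMerge M μ ν g := by
  have hac := signalLaw_absolutelyContinuous M h
  induction hg using Submodule.span_induction with
  | mem g hg =>
    obtain ⟨φ, F, rfl⟩ := hg
    exact estimatesMerge_obsProdExpectation M h φ F
  | zero =>
    have e : ∀ κ : Measure S, ∀ t ω, signalEstimate M κ 0 t ω = 0 := fun κ t ω => by
      simp only [signalEstimate, ContinuousMap.zero_apply]
      exact congrFun condExp_zero ω
    refine Eventually.of_forall fun ω => ?_
    simp only [e, sub_zero]
    exact tendsto_const_nhds
  | add g g' _ _ hg hg' =>
    have h2 := (ae_ball_iff countable_dyadics).2 fun t _ => signalEstimate_add M μ g g' t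
    have h3 := (ae_ball_iff countable_dyadics).2 fun t _ =>
      hac.ae_le (signalEstimate_add M ν g g' t)
    filter_upwards [hg, hg', h2, h3] with ω a a' b c
    have := a.add a'
    rw [add_zero] at this
    refine tendsto_congr_dyadics (fun t ht => ?_) this
    rw [b t ht, c t ht, Pi.add_apply, Pi.add_apply]
    ring
  | smul r g _ hg =>
    have h2 := (ae_ball_iff countable_dyadics).2 fun t _ => signalEstimate_smul M μ r g t
    have h3 := (ae_ball_iff countable_dyadics).2 fun t _ =>
      hac.ae_le (signalEstimate_smul M ν r g t)
    filter_upwards [hg, h2, h3] with ω a b c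
    have := a.const_mul r
    rw [mul_zero] at this
    refine tendsto_congr_dyadics (fun t ht => ?_) this
    rw [b t ht, c t ht, Pi.smul_apply, Pi.smul_apply, smul_eq_mul, smul_eq_mul]
    ring

/-- An ε/3 argument: both estimates are sup-norm contractions in the function, and f is approximated
from the dense span. Countably many approximants and dyadic times keep the exceptional set null. -/
theorem estimatesMerge_of_isObservable (hM : M.IsObservable) (h : μ ≪ ν) (f : C(S, ℝ)) :
    EstimatesMerge M μ ν f := by
  have hac := signalLaw_absolutelyContinuous M h
  have : Nonempty S := nonempty_of_isProbabilityMeasure μ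
  have hg : ∀ n : ℕ, ∃ g ∈ (Submodule.span ℝ {g : C(S, ℝ) | ∃ φ F, g = obsProdExpectation M φ F} :
      Set C(S, ℝ)), dist f g < 1 / ((n : ℝ) + 1) := fun n =>
    Metric.mem_closure_iff.1 (dense_span_obsProdExpectation M hM f) _ (by positivity)
  choose g hg hfg using hg
  have h1 := ae_all_iff.2 fun n => EstimatesMerge.of_mem_span M h (hg n)
  have h2 := ae_all_iff.2 fun n => (ae_ball_iff countable_dyadics).2 fun t _ =>
    ae_abs_signalEstimate_sub_le M μ f (g n) t
  have h3 := ae_all_iff.2 fun n => (ae_ball_iff countable_dyadics).2 fun t _ =>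
    hac.ae_le (ae_abs_signalEstimate_sub_le M ν f (g n) t)
  filter_upwards [h1, h2, h3] with ω a b c
  rw [Metric.tendsto_nhds]
  intro ε hε
  obtain ⟨n, hn⟩ := exists_nat_one_div_lt (show 0 < ε / 3 by positivity)
  have hd := (hfg n).trans hn
  rw [dist_eq_norm] at hd
  filter_upwards [Metric.tendsto_nhds.1 (a n) (ε / 3) (by positivity),
    (inf_le_right : atTop ⊓ 𝓟 dyadics ≤ _) (mem_principal_self _)] with t ht htD
  rw [Real.dist_eq, sub_zero, abs_lt] at ht ⊢
  have b' := abs_le.1 (b n t htD)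
  have c' := abs_le.1 (c n t htD)
  constructor <;> linarith [b'.1, b'.2, c'.1, c'.2, ht.1, ht.2]

theorem isStable_of_isObservable (hM : M.IsObservable) : M.IsStable := by
  intro μ ν hμ hν hμν f πμ πν hπμ hπν
  have hac := signalLaw_absolutelyContinuous M hμν
  have h1 := estimatesMerge_of_isObservable M hM hμν f.toContinuousMap
  have h2 := (ae_ball_iff countable_dyadics).2 fun t _ => hπμ.ae_eq_condExp t
  have h3 := (ae_ball_iff countable_dyadics).2 fun t _ => hac.ae_le (hπν.ae_eq_condExp t)
  filter_upwards [h1, h2, h3, hπμ.cadlag, hac.ae_le hπν.cadlag] with ω a b c cμ cν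
  have a' : Tendsto (fun t => πμ t ω - πν t ω) (atTop ⊓ 𝓟 dyadics) (𝓝 0) :=
    tendsto_congr_dyadics (fun t ht => by rw [b t ht, c t ht]; rfl) a
  rw [Metric.tendsto_nhds]
  intro ε hε
  have hev := Metric.tendsto_nhds.1 a' (ε / 2) (by positivity)
  rw [eventually_inf_principal, eventually_atTop] at hev
  obtain ⟨T, hT⟩ := hev
  filter_upwards [eventually_ge_atTop T] with t ht
  -- The value at an arbitrary t ≥ T is the limit of values at dyadic times just after t, all beyond
  -- T and hence already small.
  have hlim : Tendsto (fun s => |πμ s ω - πν s ω|) (𝓝[dyadics ∩ Set.Ioi t] t)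
      (𝓝 |πμ t ω - πν t ω|) := by
    have hsub : dyadics ∩ Set.Ioi t ⊆ Set.Ici t := fun s hs =>
      Set.Ioi_subset_Ici_self hs.2
    exact (((cμ t).1.mono hsub).sub ((cν t).1.mono hsub)).abs
  have hle : |πμ t ω - πν t ω| ≤ ε / 2 := by
    refine le_of_tendsto hlim ?_
    filter_upwards [self_mem_nhdsWithin] with s hs
    have := hT s (ht.trans (le_of_lt hs.2)) hs.1
    rw [Real.dist_eq, sub_zero] at this
    exact this.le
  rw [Real.dist_eq, sub_zero, abs_abs]
  linarith

end Stability
end FilterStability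

/-! ### The strongly continuous semigroup of the signal on C(S). -/

namespace FilterStability
section SignalSemigroup

variable {S : Type*} [TopologicalSpace S] [MeasurableSpace S] {p : ℕ} (M : FilteringModel S p)

theorem map_XY_law (z : S × Obs p) (t : ℝ≥0) : (M.law z).map (XY t) = M.trans t z := by
  have h := map_restrict_XY_add M z 0 t (B := Set.univ) MeasurableSet.univ
  rwa [Measure.restrict_univ, zero_add, M.initial, Measure.dirac_bind (Kernel.measurable _)] at h

variable [BorelSpace S]

theorem integral_comp_X_law (t : ℝ≥0) (f : C(S, ℝ)) (z : S × Obs p) :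
    ∫ ω, f (X t ω) ∂(M.law z) = ∫ w, f w.1 ∂(M.trans t z) := by
  rw [← map_XY_law]
  exact (integral_map (f := fun w : S × Obs p => f w.1) (measurable_XY t).aemeasurable
    (f.continuous.measurable.comp measurable_fst).aestronglyMeasurable).symm

variable [CompactSpace S]

theorem integrable_fst (f : C(S, ℝ)) (m : Measure (S × Obs p)) [IsFiniteMeasure m] :
    Integrable (fun w => f w.1) m :=
  .of_bound (f.continuous.measurable.comp measurable_fst).aestronglyMeasurable ‖f‖
    (Eventually.of_forall fun _ => f.norm_coe_le_norm _)

theorem continuous_integral_trans_fst (t : ℝ≥0) (f : C(S, ℝ)) :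
    Continuous fun x : S => ∫ w, f w.1 ∂(M.trans t (x, 0)) := by
  have hm : Measurable fun w : S × Obs p => f w.1 := f.continuous.measurable.comp measurable_fst
  exact (continuous_integral_trans M t _ (by fun_prop) hm
    ⟨‖f‖, fun w => f.norm_coe_le_norm _⟩).comp
      (by fun_prop : Continuous fun x : S => (x, (0 : Obs p)))

/-- The semigroup of the signal on `C(S)`. -/
noncomputable def signalSemigroup (t : ℝ≥0) : C(S, ℝ) →L[ℝ] C(S, ℝ) :=
  LinearMap.mkContinuous
    { toFun := fun f => ⟨fun x => ∫ w, f w.1 ∂(M.trans t (x, 0)),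
        continuous_integral_trans_fst M t f⟩
      map_add' := fun f g => by
        ext x
        exact integral_add (integrable_fst f _) (integrable_fst g _)
      map_smul' := fun c f => by
        ext x
        exact integral_const_mul c _ } 1 fun f => by
    rw [one_mul, ContinuousMap.norm_le _ (norm_nonneg f)]
    exact fun x => abs_integral_le_of_bdd fun w => f.norm_coe_le_norm _

theorem signalSemigroup_apply (t : ℝ≥0) (f : C(S, ℝ)) (x : S) :
    signalSemigroup M t f x = ∫ w, f w.1 ∂(M.trans t (x, 0)) := rfl

theorem norm_signalSemigroup_apply_le (t : ℝ≥0) (f : C(S, ℝ)) :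
    ‖signalSemigroup M t f‖ ≤ ‖f‖ := by
  rw [ContinuousMap.norm_le _ (norm_nonneg f)]
  exact fun x => abs_integral_le_of_bdd fun w => f.norm_coe_le_norm _

theorem integral_comp_X_eq_signalSemigroup (t : ℝ≥0) (f : C(S, ℝ)) (x : S) (y : Obs p) :
    ∫ ω, f (X t ω) ∂(M.law (x, y)) = signalSemigroup M t f x := by
  rw [signalSemigroup_apply, ← integral_comp_X_law]
  exact M.cond_indep_increments _ (measurable_comp_X_sup f.continuous.measurable t)
    ⟨‖f‖, fun ω => f.norm_coe_le_norm _⟩ x y 0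

theorem signalSemigroup_zero (f : C(S, ℝ)) : signalSemigroup M 0 f = f := by
  ext x
  rw [signalSemigroup_apply, M.feller.zero, Kernel.id_apply]
  exact integral_dirac' (fun w : S × Obs p => f w.1) _
    (f.continuous.measurable.comp measurable_fst).stronglyMeasurable

/-- After time s the pair sits at a random (x', y'), whereas the semigroup always starts the
observation at 0; independence of expectations from y reconciles the two. -/
theorem signalSemigroup_add (s t : ℝ≥0) (f : C(S, ℝ)) :
    signalSemigroup M (s + t) f = signalSemigroup M s (signalSemigroup M t f) := by
  ext x
  rw [signalSemigroup_apply, signalSemigroup_apply, M.feller.add,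
    Kernel.integral_comp (integrable_fst f _)]
  refine integral_congr_ae (Eventually.of_forall fun w => ?_)
  simp only
  rw [← integral_comp_X_law, ← integral_comp_X_eq_signalSemigroup M t f w.1 w.2]

/-- A function of the signal alone need not vanish at infinity on `S × ℝ^p`, so it is multiplied by
a cutoff χ equal to 1 at y = 0. The error is at most ‖f‖(1 - T_t χ(x, 0)), which strong continuity
applied to χ itself makes uniformly small. -/
theorem tendsto_signalSemigroup_zero (f : C(S, ℝ)) :
    Tendsto (fun t => signalSemigroup M t f) (𝓝 0) (𝓝 f) := by
  have hone := M.feller.strongly_continuous (mulCutoff (S := S) (p := p)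
    (k := fun _ => (1 : ℝ)) continuous_const (C := 1) (by simp) 0)
  have hf := M.feller.strongly_continuous (mulCutoff (S := S) (p := p) (k := fun w => f w.1)
    (by fun_prop) (C := ‖f‖) (fun w => f.norm_coe_le_norm _) 0)
  rw [Metric.tendstoUniformly_iff] at hone hf
  rw [Metric.tendsto_nhds]
  intro ε hε
  filter_upwards [hone (ε / (4 * (‖f‖ + 1))) (by positivity), hf (ε / 4) (by positivity)]
    with t h1 h2
  rw [dist_eq_norm]
  refine lt_of_le_of_lt ((ContinuousMap.norm_le _ (by positivity : (0 : ℝ) ≤ ε / 2)).2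
    fun x => ?_) (by linarith)
  have a1 := h1 (x, 0)
  have a2 := h2 (x, 0)
  have e : ∀ w, mulCutoff (S := S) (p := p) (k := fun _ => (1 : ℝ)) continuous_const (C := 1)
      (by simp) 0 w = cutoff 0 w.2 := fun w => one_mul _
  have e' : ∀ w, mulCutoff (S := S) (p := p) (k := fun w => f w.1) (by fun_prop) (C := ‖f‖)
      (fun w => f.norm_coe_le_norm _) 0 w = f w.1 * cutoff 0 w.2 := fun w => rfl
  simp only [e, e', cutoff_zero_right, mul_one, Real.dist_eq] at a1 a2
  have a3 := abs_integral_sub_integral_mul_cutoff_le M t (k := fun w => f w.1)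
    (f.continuous.measurable.comp measurable_fst) (fun w => f.norm_coe_le_norm _) 0 (x, 0)
  rw [ContinuousMap.sub_apply, signalSemigroup_apply, Real.norm_eq_abs]
  have a4 : ‖f‖ * (1 - ∫ w', cutoff 0 w'.2 ∂(M.trans t (x, 0))) ≤ ε / 4 := by
    have h5 := (le_abs_self _).trans a1.le
    calc _ ≤ ‖f‖ * (ε / (4 * (‖f‖ + 1))) := mul_le_mul_of_nonneg_left h5 (norm_nonneg _)
      _ ≤ ε / 4 := by
        rw [mul_div_assoc', div_le_div_iff₀ (by positivity) (by norm_num)]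
        nlinarith [norm_nonneg f]
  rw [abs_sub_comm] at a2
  have := abs_sub_le (∫ w, f w.1 ∂(M.trans t (x, 0)))
    (∫ w', f w'.1 * cutoff 0 w'.2 ∂(M.trans t (x, 0))) (f x)
  linarith

theorem continuous_signalSemigroup (f : C(S, ℝ)) : Continuous fun t => signalSemigroup M t f := by
  refine continuous_iff_continuousAt.2 fun t₀ => ?_
  -- Subtraction is truncated, so at most one of the two terms is nonzero and both time orders are
  -- covered by a single bound.
  have hle : ∀ t, dist (signalSemigroup M t f) (signalSemigroup M t₀ f) ≤
      ‖signalSemigroup M (t - t₀) f - f‖ + ‖signalSemigroup M (t₀ - t) f - f‖ := by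
    have key : ∀ s t : ℝ≥0, s ≤ t → dist (signalSemigroup M t f) (signalSemigroup M s f) ≤
        ‖signalSemigroup M (t - s) f - f‖ := by
      intro s t hst
      have : signalSemigroup M t f = signalSemigroup M s (signalSemigroup M (t - s) f) := by
        rw [← signalSemigroup_add, add_tsub_cancel_of_le hst]
      rw [this, dist_eq_norm, ← map_sub]
      exact norm_signalSemigroup_apply_le M s _
    intro t
    rcases le_total t₀ t with h | h
    · exact (key t₀ t h).trans (le_add_of_nonneg_right (norm_nonneg _))
    · rw [dist_comm]
      exact (key t t₀ h).trans (le_add_of_nonneg_left (norm_nonneg _))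
  have h0 : Tendsto (fun t => ‖signalSemigroup M t f - f‖) (𝓝 0) (𝓝 0) :=
    tendsto_iff_norm_sub_tendsto_zero.1 (tendsto_signalSemigroup_zero M f)
  have l1 : Tendsto (fun t : ℝ≥0 => t - t₀) (𝓝 t₀) (𝓝 0) := by
    have : Continuous fun t : ℝ≥0 => t - t₀ := by fun_prop
    simpa using this.tendsto t₀
  have l2 : Tendsto (fun t : ℝ≥0 => t₀ - t) (𝓝 t₀) (𝓝 0) := by
    have : Continuous fun t : ℝ≥0 => t₀ - t := by fun_prop
    simpa using this.tendsto t₀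
  have := (h0.comp l1).add (h0.comp l2)
  rw [add_zero] at this
  exact tendsto_iff_dist_tendsto_zero.2 (squeeze_zero (fun _ => dist_nonneg) hle this)

/-- Every `f ∈ C(S)` is a uniform limit of functions along which the signal semigroup is Lipschitz
in time. -/
theorem exists_lipschitz_approx (f : C(S, ℝ)) {ε : ℝ} (hε : 0 < ε) :
    ∃ g : C(S, ℝ), ‖f - g‖ ≤ ε ∧ ∃ c : ℝ, 0 ≤ c ∧
      ∀ t : ℝ≥0, ‖signalSemigroup M t g - g‖ ≤ c * t := by
  set u : ℝ → C(S, ℝ) := fun s => signalSemigroup M s.toNNReal f with hu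
  have huc : Continuous u := (continuous_signalSemigroup M f).comp continuous_real_toNNReal
  have hui : ∀ a b : ℝ, IntervalIntegrable u volume a b := fun a b => huc.intervalIntegrable a b
  have hun : ∀ s, ‖u s‖ ≤ ‖f‖ := fun s => norm_signalSemigroup_apply_le M _ f
  have hu0 : u 0 = f := by simp only [hu, Real.toNNReal_zero, signalSemigroup_zero]
  obtain ⟨δ, hδ, hδu⟩ := Metric.continuousAt_iff.1 (huc.continuousAt (x := (0 : ℝ))) ε hε
  set h : ℝ := δ / 2 with hh
  have hh0 : 0 < h := by positivity
  -- Time averaging smooths: T_t shifts the window of integration, and only two pieces of length t,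
  -- each of norm at most ‖f‖t, fail to cancel. After division by h this is the constant 2‖f‖/h.
  refine ⟨h⁻¹ • ∫ s in (0 : ℝ)..h, u s, ?_, 2 * ‖f‖ / h, by positivity, fun t => ?_⟩
  · have e : f - h⁻¹ • ∫ s in (0 : ℝ)..h, u s = h⁻¹ • ∫ s in (0 : ℝ)..h, (f - u s) := by
      rw [intervalIntegral.integral_sub intervalIntegrable_const (hui _ _),
        intervalIntegral.integral_const, sub_zero, smul_sub, smul_smul, inv_mul_cancel₀ hh0.ne',
        one_smul]
    have hb : ‖∫ s in (0 : ℝ)..h, (f - u s)‖ ≤ ε * |h - 0| := by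
      refine intervalIntegral.norm_integral_le_of_norm_le_const fun s hs => ?_
      rw [Set.uIoc_of_le hh0.le] at hs
      have := hδu (x := s) (by rw [Real.dist_eq, sub_zero, abs_of_pos hs.1]; linarith [hs.2])
      rw [hu0, dist_comm, dist_eq_norm] at this
      exact this.le
    rw [e, norm_smul, norm_inv, Real.norm_eq_abs, abs_of_pos hh0, inv_mul_le_iff₀ hh0]
    rw [sub_zero, abs_of_pos hh0] at hb
    linarith
  · have e1 : signalSemigroup M t (∫ s in (0 : ℝ)..h, u s) = ∫ s in (t : ℝ)..(h + t), u s := by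
      rw [← ContinuousLinearMap.intervalIntegral_comp_comm _ (hui _ _)]
      have : ∫ s in (t : ℝ)..(h + t), u s = ∫ s in (0 : ℝ)..h, u (s + t) := by
        rw [intervalIntegral.integral_comp_add_right, zero_add]
      rw [this]
      refine intervalIntegral.integral_congr fun s hs => ?_
      rw [Set.uIcc_of_le hh0.le] at hs
      simp only [hu]
      rw [← signalSemigroup_add, Real.toNNReal_add hs.1 (NNReal.coe_nonneg t), Real.toNNReal_coe,
        add_comm]
    rw [map_smul, e1, ← smul_sub, intervalIntegral.integral_interval_sub_interval_comm (hui _ _)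
      (hui _ _) (hui _ _), norm_smul, norm_inv, Real.norm_eq_abs, abs_of_pos hh0,
      inv_mul_le_iff₀ hh0]
    have b1 : ‖∫ s in (t : ℝ)..0, u s‖ ≤ ‖f‖ * |0 - (t : ℝ)| :=
      intervalIntegral.norm_integral_le_of_norm_le_const fun s _ => hun s
    have b2 : ‖∫ s in (h + t)..h, u s‖ ≤ ‖f‖ * |h - (h + t)| :=
      intervalIntegral.norm_integral_le_of_norm_le_const fun s _ => hun s
    rw [zero_sub, abs_neg, NNReal.abs_eq] at b1
    rw [sub_add_cancel_left, abs_neg, NNReal.abs_eq] at b2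
    calc _ ≤ ‖f‖ * t + ‖f‖ * t := (norm_sub_le _ _).trans (add_le_add b1 b2)
      _ = h * (2 * ‖f‖ / h * t) := by field_simp; ring

end SignalSemigroup
end FilterStability

/-! ### Existence of the càdlàg version of the filter. -/

namespace FilterStability
section CadlagVersion

variable {S : Type*} [TopologicalSpace S] [MeasurableSpace S] {p : ℕ} (M : FilteringModel S p)

theorem measurableSet_obsFiltration_of_forall_gt {t : ℝ≥0} {A : Set (PathSpace S p)}
    (h : ∀ r > t, MeasurableSet[M.obsFiltration r] A) : MeasurableSet[M.obsFiltration t] A := by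
  refine ⟨(h (t + 1) (by simp)).1, fun s hs ρ hρ => ?_⟩
  obtain ⟨r, htr, hrs⟩ := exists_between hs
  exact (h r htr).2 s hrs ρ hρ

variable [BorelSpace S] [CompactSpace S] (μ : Measure S) [IsProbabilityMeasure μ]

theorem condExp_comp_X_add (s r : ℝ≥0) (g : C(S, ℝ)) :
    (M.signalLaw μ)[fun ω => g (X (s + r) ω) | M.obsFiltration s] =ᵐ[M.signalLaw μ]
      signalEstimate M μ (signalSemigroup M r g) s := by
  refine condExp_pathShift_obs M μ s (ψ := fun ω => g (X r ω))
    (g.continuous.measurable.comp (measurable_X r)) (fun ω => g.norm_coe_le_norm _)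
    (signalSemigroup M r g).continuous (integral_comp_X_eq_signalSemigroup M r g) fun ω => ?_
  refine (g.continuous.tendsto _).comp ((tendsto_X_nhdsGT (s + r) ω).comp
    (tendsto_nhdsWithin_iff.2 ⟨(by fun_prop : Continuous fun s : ℝ≥0 =>
      s + r).continuousAt.tendsto.mono_left nhdsWithin_le_nhds, ?_⟩))
  filter_upwards [self_mem_nhdsWithin] with u hu
  simpa using hu

theorem condExp_signalEstimate {s t : ℝ≥0} (hst : s ≤ t) (g : C(S, ℝ)) :
    (M.signalLaw μ)[signalEstimate M μ g t | M.obsFiltration s] =ᵐ[M.signalLaw μ]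
      signalEstimate M μ (signalSemigroup M (t - s) g) s := by
  have h := condExp_comp_X_add M μ s (t - s) g
  rw [add_tsub_cancel_of_le hst] at h
  exact (condExp_condExp_of_le (M.obsFiltration.mono hst) (M.obsFiltration.le t)).trans h

/-- Conditioning the estimate of g at t on 𝓕^Y_s gives the estimate of T_{t-s} g at s, which is
below that of g by at most c(t - s); the drift ct compensates this loss. -/
theorem submartingale_signalEstimate_add_mul {g : C(S, ℝ)} {c : ℝ}
    (hg : ∀ t : ℝ≥0, ‖signalSemigroup M t g - g‖ ≤ c * t) :
    Submartingale (fun t ω => signalEstimate M μ g t ω + c * t) M.obsFiltration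
      (M.signalLaw μ) := by
  refine ⟨fun t => stronglyMeasurable_condExp.add stronglyMeasurable_const, fun s t hst => ?_,
    fun t => integrable_condExp.add (integrable_const _)⟩
  have h1 : (M.signalLaw μ)[fun ω => signalEstimate M μ g t ω + c * t | M.obsFiltration s]
      =ᵐ[M.signalLaw μ] fun ω => (M.signalLaw μ)[signalEstimate M μ g t | M.obsFiltration s] ω
        + c * t := by
    have h := condExp_add (μ := M.signalLaw μ) (f := signalEstimate M μ g t)
      (g := fun _ => c * (t : ℝ)) integrable_condExp (integrable_const _) (M.obsFiltration s)
    rwa [condExp_const (M.obsFiltration.le s)] at h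
  filter_upwards [h1, condExp_signalEstimate M μ hst g,
    ae_abs_signalEstimate_sub_le M μ (signalSemigroup M (t - s) g) g s] with ω a b d
  have e := hg (t - s)
  rw [NNReal.coe_sub hst] at e
  rw [a, b]
  have := (abs_le.1 d).1
  linarith

/-- The submartingale argument covers functions Lipschitz along the semigroup; contraction of the
estimates transfers the limits to arbitrary f by uniform approximation. -/
theorem ae_hasDyadicLimits_signalEstimate (f : C(S, ℝ)) :
    ∀ᵐ ω ∂(M.signalLaw μ), HasDyadicLimits fun t => signalEstimate M μ f t ω := by
  have hpos : ∀ n : ℕ, (0 : ℝ) < 1 / ((n : ℝ) + 1) := fun n => by positivity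
  choose g hfg c hc hg using fun n => exists_lipschitz_approx M f (hpos n)
  have h1 : ∀ᵐ ω ∂(M.signalLaw μ), ∀ n, HasDyadicLimits fun t => signalEstimate M μ (g n) t ω := by
    refine ae_all_iff.2 fun n => ?_
    have hb : ∀ N : ℕ, ∃ K : ℝ, ∀ t ≤ (N : ℝ≥0), ∀ᵐ ω ∂(M.signalLaw μ),
        |signalEstimate M μ (g n) t ω + c n * t| ≤ K := fun N => ⟨‖g n‖ + c n * N, fun t ht => by
      filter_upwards [ae_abs_signalEstimate_le M μ (g n) t] with ω hω
      refine (abs_add_le _ _).trans (add_le_add hω ?_)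
      rw [abs_mul, abs_of_nonneg (hc n), NNReal.abs_eq]
      exact mul_le_mul_of_nonneg_left (by exact_mod_cast ht) (hc n)⟩
    filter_upwards [ae_hasDyadicLimits_of_submartingale
      (submartingale_signalEstimate_add_mul M μ (hg n)) hb] with ω hω
    simpa using hω.sub_continuous (y := fun t : ℝ≥0 => c n * t) (by fun_prop)
  have h2 := ae_all_iff.2 fun n => (ae_ball_iff countable_dyadics).2 fun t _ =>
    ae_abs_signalEstimate_sub_le M μ f (g n) t
  filter_upwards [h1, h2] with ω a b
  refine .of_approx fun ε hε => ?_
  obtain ⟨n, hn⟩ := exists_nat_one_div_lt hε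
  exact ⟨_, a n, fun t ht => (b n t ht).trans ((hfg n).trans hn.le)⟩

/-- For A observed by time t, the integrals over A of the estimate and of f(X) agree at every later
time. Letting dyadic times decrease to t identifies the right limit, provided it is measurable at
time t, which comes from right-continuity of the filtration. -/
theorem rightDyadicLim_ae_eq_condExp (f : C(S, ℝ)) (t : ℝ≥0) :
    (fun ω => rightDyadicLim (fun s => signalEstimate M μ f s ω) t) =ᵐ[M.signalLaw μ]
      (M.signalLaw μ)[fun ω => f (X t ω) | M.obsFiltration t] := by
  obtain ⟨s, hs⟩ := exists_seq_tendsto (𝓝[dyadics ∩ Set.Ioi t] t)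
  have hs' : Tendsto s atTop (𝓝[>] t) :=
    hs.mono_right (nhdsWithin_mono _ Set.inter_subset_right)
  have hgt : ∀ᶠ n in atTop, t < s n := hs'.eventually self_mem_nhdsWithin
  have hbdd := ae_all_iff.2 fun n => ae_abs_signalEstimate_le M μ f (s n)
  set R : PathSpace S p → ℝ := fun ω => rightDyadicLim (fun s => signalEstimate M μ f s ω) t
  -- The limsup is an everywhere defined, measurable substitute for the limit, which exists only
  -- almost surely.
  set L : PathSpace S p → ℝ := fun ω => limsup (fun n => signalEstimate M μ f (s n) ω) atTop
    with hL
  have hlim : ∀ᵐ ω ∂(M.signalLaw μ),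
      Tendsto (fun n => signalEstimate M μ f (s n) ω) atTop (𝓝 (R ω)) := by
    filter_upwards [ae_hasDyadicLimits_signalEstimate M μ f] with ω hω
    exact (hω.tendsto_rightDyadicLim t).comp hs
  have hLm : Measurable[M.obsFiltration t] L := by
    intro B hB
    refine measurableSet_obsFiltration_of_forall_gt M fun r hr => ?_
    have hlt : ∀ᶠ n in atTop, s n < r :=
      (hs'.mono_right nhdsWithin_le_nhds).eventually (Iio_mem_nhds hr)
    -- Dropping the first N terms leaves the limsup unchanged and involves only times before r; as r
    -- > t is arbitrary, the limsup is measurable at t.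
    obtain ⟨N, hN⟩ := eventually_atTop.1 hlt
    have hLN : L = fun ω => limsup (fun n => signalEstimate M μ f (s (n + N)) ω) atTop :=
      funext fun ω => (limsup_nat_add (fun n => signalEstimate M μ f (s n) ω) N).symm
    rw [hLN]
    refine Measurable.limsup (fun n => ?_) hB
    exact stronglyMeasurable_condExp.measurable.mono
      (M.obsFiltration.mono (hN _ (Nat.le_add_left N n)).le) le_rfl
  have hRL : L =ᵐ[M.signalLaw μ] R := by
    filter_upwards [hlim] with ω hω using hω.limsup_eq
  have hRb : ∀ᵐ ω ∂(M.signalLaw μ), |R ω| ≤ ‖f‖ := by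
    filter_upwards [hlim, hbdd] with ω a b
    exact le_of_tendsto a.abs (Eventually.of_forall b)
  have hRm : AEStronglyMeasurable[M.obsFiltration t] R (M.signalLaw μ) :=
    ⟨L, hLm.stronglyMeasurable, hRL.symm⟩
  refine ae_eq_condExp_of_forall_setIntegral_eq (M.obsFiltration.le t)
    (integrable_comp_X f t _)
    (fun A _ _ => (Integrable.of_bound (hRm.mono (M.obsFiltration.le t)) ‖f‖ hRb).integrableOn)
    (fun A hA _ => ?_) hRm
  have l1 : Tendsto (fun n => ∫ ω in A, signalEstimate M μ f (s n) ω ∂(M.signalLaw μ)) atTop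
      (𝓝 (∫ ω in A, R ω ∂(M.signalLaw μ))) :=
    tendsto_integral_of_dominated_convergence (fun _ => ‖f‖)
      (fun n => integrable_condExp.aestronglyMeasurable.restrict) (integrable_const _)
      (fun n => ae_restrict_of_ae (ae_abs_signalEstimate_le M μ f (s n)))
      (ae_restrict_of_ae hlim)
  have l2 : Tendsto (fun n => ∫ ω in A, f (X (s n) ω) ∂(M.signalLaw μ)) atTop
      (𝓝 (∫ ω in A, f (X t ω) ∂(M.signalLaw μ))) :=
    tendsto_integral_of_dominated_convergence (fun _ => ‖f‖)
      (fun n => (integrable_comp_X f (s n) _).aestronglyMeasurable) (integrable_const _)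
      (fun n => Eventually.of_forall fun ω => f.norm_coe_le_norm _)
      (Eventually.of_forall fun ω => (f.continuous.tendsto _).comp
        ((tendsto_X_nhdsGT t ω).comp hs'))
  refine tendsto_nhds_unique l1 (l2.congr' ?_)
  filter_upwards [hgt] with n hn
  exact (setIntegral_condExp (M.obsFiltration.le (s n)) (integrable_comp_X f (s n) _)
    (M.obsFiltration.mono hn.le A hA)).symm

theorem exists_isFilter (f : S →ᵇ ℝ) : ∃ π, M.IsFilter μ f π :=
  ⟨fun t ω => rightDyadicLim (fun s => signalEstimate M μ f.toContinuousMap s ω) t,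
    fun t => rightDyadicLim_ae_eq_condExp M μ f.toContinuousMap t, by
      filter_upwards [ae_hasDyadicLimits_signalEstimate M μ f.toContinuousMap] with ω hω
        using hω.isCadlag_rightDyadicLim⟩

end CadlagVersion
end FilterStability

theorem mainTheorem2 {S : Type*} [TopologicalSpace S] [CompactSpace S] [PolishSpace S]
    [MeasurableSpace S] [BorelSpace S] {p : ℕ} (M : FilterStability.FilteringModel S p) :
    (∀ μ : Measure S, IsProbabilityMeasure μ → ∀ f : BoundedContinuousFunction S ℝ,
      ∃ π, M.IsFilter μ f π) ∧
    (M.IsObservable → M.IsStable) := by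
  exact ⟨fun μ _ f => FilterStability.exists_isFilter M μ f,
    FilterStability.isStable_of_isObservable M⟩
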